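/- Let $n\ge 2$ and $p\ge 0$. For $i=1,\dots,n$ let $f_i:\mathbb{R}^{d_i}\to\mathbb{R}$ be differentiable with locally Lipschitz gradient and $\mu_i$-strongly convex, $\mu_i>0$, and let $A_i\in\mathbb{R}^{p\times d_i}$, $b,b_1,\dots,b_n\in\mathbb{R}^p$ with $\sum_{i=1}^n b_i=b$. Consider the problem $$\min_{x_1\in\mathbb{R}^{d_1},\dots,x_n\in\mathbb{R}^{d_n}}\ \sum_{i=1}^n f_i(x_i)\quad\text{subject to}\quad \sum_{i=1}^n A_ix_i=b, \tag{P}$$ and suppose that it is feasible. Let $\mathcal{G}$ be a strongly connected, weight-balanced digraph on $\{1,\dots,n\}$ with weights $a_{ij}\ge 0$ ($a_{ij}>0$ exactly for the edges $(i,j)$; weight-balanced means $\sum_j a_{ji}=\sum_j a_{ij}$ for all $i$), let $L=\operatorname{diag}\{\sum_j a_{1j},\dots,\sum_j a_{nj}\}-[a_{ij}]$ be its Laplacian, and let $\eta_2(\hat L)$ be the second smallest eigenvalue (counted with multiplicity) of $\hat L=\frac{L+L^\top}{2}$. Put $\mathbf{A}=\operatorname{diag}\{A_1,\dots,A_n\}$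 (block diagonal), with largest singular value $\bar\sigma(\mathbf{A})$, $\mathbf{b}=[b_1^\top,\dots,b_n^\top]^\top$, $\mathbf{L}=L\otimes I_p$, $f(\mathbf{x})=\sum_{i=1}^n f_i(x_i)$ for $\mathbf{x}=[x_1^\top,\dots,x_n^\top]^\top\in\mathbb{R}^d$, $d=\sum_i d_i$, and $\mu=\min_i\mu_i$. IDEA is the system $$\begin{aligned}\dot{\mathbf{x}}&=-\alpha\big(\nabla f(\mathbf{x})+\mathbf{A}^\top\boldsymbol{\lambda}\big)-\mathbf{A}^\top(\mathbf{A}\mathbf{x}-\mathbf{b}-\mathbf{z}),\\ \dot{\boldsymbol{\lambda}}&=\mathbf{A}\mathbf{x}-\mathbf{b}-\mathbf{z}-\beta\mathbf{L}\boldsymbol{\lambda},\\ \dot{\mathbf{z}}&=\alpha\beta\mathbf{L}\boldsymbol{\lambda},\end{aligned}$$ with $\mathbf{x}\in\mathbb{R}^d$, $\boldsymbol{\lambda}=[\lambda_1^\top,\dots,\lambda_n^\top]^\top\in\mathbb{R}^{np}$ and $\mathbf{z}=[z_1^\top,\dots,z_n^\top]^\top\in\mathbb{R}^{np}$. Let $\varphi>0$,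 and let $\alpha>0$ and $\beta$ satisfy $$\alpha\ \ge\ \frac{(\varphi^2+3\varphi+3)\,\bar\sigma(\mathbf{A})^2}{(\varphi+1)\mu},\qquad \beta\ \ge\ \frac{(\varphi+1)^2\alpha}{\varphi\,\eta_2(\hat L)}.$$ Then for every initial state $(\mathbf{x}(0),\boldsymbol{\lambda}(0),\mathbf{z}(0))\in\mathbb{R}^d\times\mathbb{R}^{np}\times\mathbb{R}^{np}$ with $\sum_{i=1}^n z_i(0)=0$, IDEA has a solution on $[0,\infty)$ starting there, and every such solution converges, as $t\to\infty$, to an equilibrium $(\mathbf{x}^*,\boldsymbol{\lambda}^*,\mathbf{z}^*)$ of IDEA whose component $\mathbf{x}^*$ is the unique optimal solution of (P). -/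

import Mathlib

open Filter Topology
open scoped Gradient

/-- A weighted digraph on the agents `Fin n`, given by its weighted adjacency matrix `[a_ij]` with
nonnegative entries; `(i, j)` is an edge exactly when `a_ij > 0`. Self-loops are allowed. -/
structure WeightedDigraph (n : ℕ) where
  weight : Matrix (Fin n) (Fin n) ℝ
  weight_nonneg : ∀ i j, 0 ≤ weight i j

namespace WeightedDigraph

variable {n : ℕ} (G : WeightedDigraph n)

/-- `(i, j)` is an edge: agent `i` can receive information sent by agent `j`. -/
def Edge (i j : Fin n) : Prop := 0 < G.weight i j

/-- The in-degree `d_i^in = ∑ j, a_ji`. -/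
def inDegree (i : Fin n) : ℝ := ∑ j, G.weight j i

/-- The out-degree `d_i^out = ∑ j, a_ij`. -/
def outDegree (i : Fin n) : ℝ := ∑ j, G.weight i j

/-- In-degree and out-degree agree at each vertex. -/
def WeightBalanced : Prop := ∀ i, G.inDegree i = G.outDegree i

/-- Any two vertices are joined by a directed path. -/
def StronglyConnected : Prop := ∀ i j, Relation.ReflTransGen G.Edge i j

/-- The Laplacian `L = D^out - [a_ij]`. -/
def laplacian : Matrix (Fin n) (Fin n) ℝ := Matrix.diagonal G.outDegree - G.weight

/-- The symmetric part `(L + Lᵀ) / 2` of the Laplacian. -/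
noncomputable def symLaplacian : Matrix (Fin n) (Fin n) ℝ :=
  (1 / 2 : ℝ) • (G.laplacian + G.laplacian.transpose)

theorem symLaplacian_isHermitian : G.symLaplacian.IsHermitian := by
  unfold symLaplacian Matrix.IsHermitian
  rw [Matrix.conjTranspose_eq_transpose_of_trivial, Matrix.transpose_smul, Matrix.transpose_add,
    Matrix.transpose_transpose, add_comm]

end WeightedDigraph

/-- The second smallest eigenvalue, counted with multiplicity, of a real symmetric matrix of size
at least two. (`eigenvalues₀` lists the eigenvalues in decreasing order.) -/
noncomputable def secondSmallestEigenvalue {n : ℕ} (hn : 2 ≤ n) {M : Matrix (Fin n) (Fin n) ℝ}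
    (hM : M.IsHermitian) : ℝ :=
  hM.eigenvalues₀ ⟨n - 2, by rw [Fintype.card_fin]; omega⟩

/-- The largest singular value of a real matrix (`singularValues` is in decreasing order, starting
at index `0`; the value is `0` for a matrix without columns). -/
noncomputable def largestSingularValue {m k : Type*} [Fintype m] [Fintype k] [DecidableEq k]
    (M : Matrix m k ℝ) : ℝ :=
  (Matrix.toEuclideanLin M).singularValues 0

/-- The data of the problem `min ∑ i, f_i (x_i)` subject to `∑ i, A_i x_i = b`, where
`x_i ∈ ℝ^{d_i}`, `A_i ∈ ℝ^{p × d_i}` and `b ∈ ℝ^p`. -/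
structure CoupledProblem (n p : ℕ) where
  d : Fin n → ℕ
  f : ∀ i, EuclideanSpace ℝ (Fin (d i)) → ℝ
  A : ∀ i, Matrix (Fin p) (Fin (d i)) ℝ
  b : EuclideanSpace ℝ (Fin p)

namespace CoupledProblem

variable {n p : ℕ} (P : CoupledProblem n p)

/-- The decision variables `(x_1, …, x_n)`. -/
abbrev Decision : Type := ∀ i, EuclideanSpace ℝ (Fin (P.d i))

/-- The total cost. -/
def cost (x : P.Decision) : ℝ := ∑ i, P.f i (x i)

/-- The coupled equality constraint. -/
def Feasible (x : P.Decision) : Prop := ∑ i, Matrix.toEuclideanLin (P.A i) (x i) = P.b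

/-- `x` is an optimal solution. -/
def IsOptimal (x : P.Decision) : Prop := P.Feasible x ∧ ∀ y, P.Feasible y → P.cost x ≤ P.cost y

/-- The block diagonal matrix `diag {A_1, …, A_n}`. -/
def blockA : Matrix ((_ : Fin n) × Fin p) ((i : Fin n) × Fin (P.d i)) ℝ :=
  Matrix.blockDiagonal' P.A

/-- The states `(x, λ, z)`, with one block of each of the three parts for every agent. -/
abbrev State : Type :=
  P.Decision × (Fin n → EuclideanSpace ℝ (Fin p)) × (Fin n → EuclideanSpace ℝ (Fin p))

/-- The vector field of IDEA. The splitting `bloc` of `b` among the agents enters through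
`r_i = A_i x_i - b_i - z_i`, and `(𝐋 λ)_i = ∑ j, L_ij λ_j` for `𝐋 = L ⊗ I_p`. -/
noncomputable def ideaField (G : WeightedDigraph n) (bloc : Fin n → EuclideanSpace ℝ (Fin p))
    (α β : ℝ) (s : P.State) : P.State :=
  let x := s.1
  let lam := s.2.1
  let z := s.2.2
  let r : Fin n → EuclideanSpace ℝ (Fin p) :=
    fun i => Matrix.toEuclideanLin (P.A i) (x i) - bloc i - z i
  let Llam : Fin n → EuclideanSpace ℝ (Fin p) := fun i => ∑ j, G.laplacian i j • lam j
  (fun i => -(α • (∇ (P.f i) (x i) + Matrix.toEuclideanLin (P.A i).transpose (lam i)))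
      - Matrix.toEuclideanLin (P.A i).transpose (r i),
    fun i => r i - β • Llam i,
    fun i => (α * β) • Llam i)

/-- `s` is an equilibrium point of IDEA. -/
def IsIdeaEquilibrium (G : WeightedDigraph n) (bloc : Fin n → EuclideanSpace ℝ (Fin p))
    (α β : ℝ) (s : P.State) : Prop :=
  P.ideaField G bloc α β s = 0

/-- `u` is a trajectory of IDEA on `[0, ∞)` (one-sided derivative at `0`). -/
def IsIdeaTrajectory (G : WeightedDigraph n) (bloc : Fin n → EuclideanSpace ℝ (Fin p))
    (α β : ℝ) (u : ℝ → P.State) : Prop :=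
  ∀ t, 0 ≤ t → HasDerivWithinAt u (P.ideaField G bloc α β (u t)) (Set.Ici 0) t

end CoupledProblem

/-! A KKT point `x` of (P) with multiplier `l` exists by coercivity and the identity "orthogonal
complement of the kernel = range of the adjoint" (`exists_kkt`). It yields an equilibrium `e` whose
multipliers all equal `l` and whose `z` is the residual `A x - b`. Weight balance makes the block
sum of `z` invariant, so `z - e.z` stays zero-sum.

The Lyapunov function is a weighted sum of `‖x‖²`, `‖α λ + z‖²` and `‖λ‖²`, all taken as deviations
from `e`. The Laplacian cancels in `α λ' + z'`, and the weights cancel the products of `λ` with `A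
x`. The remaining product of `λ` with `z` sees only the non-consensus part of `λ`, because `z` is
zero-sum; the spectral gap `η₂` and the bound on `β` absorb it. Strong monotonicity and the bound on
`α` absorb the product of `z` with `A x` (`lyapunovDeriv_field_le`). Bounded sublevel sets then give
global existence.

This decay does not control the consensus part of `λ`, whose limit need not be unique. Adding a
small multiple of `⟪A x, λ⟫` contributes `-‖Aᵀ λ‖²` to the derivative (`exists_strict_decrease`).
The new decay rate vanishes, among states reached as limits, only at equilibria with the same `x`.
Along some sequence of times it tends to zero, so by compactness the trajectory has such an
equilibrium as a limit point. The Lyapunov function centred there is also decreasing, hence tends to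
zero, and the whole trajectory converges (`exists_tendsto`). -/

open scoped RealInnerProductSpace

set_option linter.unusedSectionVars false

/-! ### Global existence from an a priori bound -/

/-- A locally Lipschitz vector field all of whose damped trajectories from `s₀` stay in a fixed ball
has a trajectory from `s₀` on `[0, ∞)`. -/
theorem exists_forall_nonneg_hasDerivWithinAt {E : Type*} [NormedAddCommGroup E] [NormedSpace ℝ E]
    [ProperSpace E] {g : E → E} (hg : LocallyLipschitz g) (s₀ : E) (R : ℝ)
    (hR : ∀ T, 0 ≤ T → ∀ θ : ℝ → ℝ, (∀ t, 0 ≤ θ t) → ∀ u : ℝ → E, u 0 = s₀ →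
      (∀ t ∈ Set.Icc 0 T, HasDerivWithinAt u (θ t • g (u t)) (Set.Icc 0 T) t) →
      ∀ t ∈ Set.Icc 0 T, ‖u t‖ ≤ R) :
    ∃ u : ℝ → E, u 0 = s₀ ∧ ∀ t, 0 ≤ t → HasDerivWithinAt u (g (u t)) (Set.Ici 0) t := by
  -- The cutoff is 1 on the ball of radius `R` and 0 outside radius `R + 1`, so `χ • g` is bounded.
  -- Its trajectories are damped trajectories of `g`, hence never leave the region where `χ = 1`.
  set χ : E → ℝ := fun s => max 0 (min 1 (R + 1 - ‖s‖)) with hχ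
  have hχ0 : ∀ s, 0 ≤ χ s := fun s => le_max_left _ _
  have hχ1 : ∀ s, χ s ≤ 1 := fun s => max_le zero_le_one (min_le_left _ _)
  have hχR : ∀ s, ‖s‖ ≤ R → χ s = 1 := by
    intro s hs
    simp only [hχ]
    rw [min_eq_left (by linarith), max_eq_right zero_le_one]
  have hχout : ∀ s, R + 1 ≤ ‖s‖ → χ s = 0 := by
    intro s hs
    exact max_eq_left ((min_le_right _ _).trans (by linarith))
  have hχlip : ∀ x y, |χ x - χ y| ≤ ‖x - y‖ := by
    intro x y
    have h1 := abs_max_sub_max_le_abs (min 1 (R + 1 - ‖x‖)) (min 1 (R + 1 - ‖y‖)) 0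
    have h2 := abs_min_sub_min_le_max 1 (R + 1 - ‖x‖) 1 (R + 1 - ‖y‖)
    have h3 := abs_norm_sub_norm_le y x
    have h4 : |R + 1 - ‖x‖ - (R + 1 - ‖y‖)| = |‖y‖ - ‖x‖| := by congr 1; ring
    rw [h4, sub_self, abs_zero, max_eq_right (abs_nonneg _)] at h2
    rw [norm_sub_rev] at h3
    simp only [hχ, max_comm (0 : ℝ)]
    exact h1.trans (h2.trans h3)
  obtain ⟨M, hM0, hM⟩ : ∃ M : ℝ, 0 ≤ M ∧ ∀ s, ‖χ s • g s‖ ≤ M := by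
    obtain ⟨M, hM⟩ := (isCompact_closedBall (0 : E) (R + 1)).exists_bound_of_continuousOn
      hg.continuous.continuousOn
    refine ⟨max M 0, le_max_right _ _, fun s => ?_⟩
    rw [norm_smul, Real.norm_of_nonneg (hχ0 s)]
    by_cases hs : ‖s‖ ≤ R + 1
    · have := hM s (by simpa using hs)
      calc χ s * ‖g s‖ ≤ 1 * ‖g s‖ := by gcongr; exact hχ1 s
        _ ≤ max M 0 := by rw [one_mul]; exact this.trans (le_max_left _ _)
    · rw [hχout s (by linarith), zero_mul]
      exact le_max_right _ _
  have hlip : ∀ a : ℝ, ∃ K : NNReal, LipschitzOnWith K g (Metric.closedBall s₀ a) := fun a =>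
    (hg.locallyLipschitzOn).exists_lipschitzOnWith_of_compact (isCompact_closedBall s₀ a)
  have hlip' : ∀ a : ℝ, ∃ K : NNReal,
      LipschitzOnWith K (fun s => χ s • g s) (Metric.closedBall s₀ a) := by
    intro a
    obtain ⟨K, hK⟩ := hlip a
    obtain ⟨B, hB⟩ := (isCompact_closedBall s₀ a).exists_bound_of_continuousOn
      hg.continuous.continuousOn
    refine ⟨K + B.toNNReal, LipschitzOnWith.of_dist_le_mul fun x hx y hy => ?_⟩
    have e : χ x • g x - χ y • g y = χ x • (g x - g y) + (χ x - χ y) • g y := by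
      rw [smul_sub, sub_smul]; abel
    have hk := hK.dist_le_mul x hx y hy
    rw [dist_eq_norm, dist_eq_norm] at hk
    rw [dist_eq_norm, e, dist_eq_norm, NNReal.coe_add, add_mul]
    refine (norm_add_le _ _).trans (add_le_add ?_ ?_)
    · rw [norm_smul, Real.norm_of_nonneg (hχ0 x)]
      calc χ x * ‖g x - g y‖ ≤ 1 * ‖g x - g y‖ := by gcongr; exact hχ1 x
        _ ≤ _ := by rw [one_mul]; exact hk
    · rw [norm_smul, Real.norm_eq_abs, mul_comm]
      have := (hB y hy).trans (Real.le_coe_toNNReal B)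
      gcongr
      exact hχlip x y
  have hloc : ∀ N : ℕ, ∃ u : ℝ → E, u 0 = s₀ ∧ ∀ t ∈ Set.Icc (0 : ℝ) (N + 1),
      ‖u t‖ ≤ R ∧ HasDerivWithinAt u (g (u t)) (Set.Icc 0 (N + 1)) t := by
    intro N
    have hN : (0 : ℝ) ≤ N + 1 := by positivity
    -- A field bounded by `M` moves a point by at most `M * (N + 1)` in time `N + 1`, so
    -- Picard–Lindelöf on this ball covers the whole interval.
    obtain ⟨K, hK⟩ := hlip' (M * (N + 1))
    have hpl : IsPicardLindelof (fun _ s => χ s • g s) (tmin := 0) (tmax := (N : ℝ) + 1)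
        ⟨0, le_rfl, hN⟩ s₀ ⟨M * (N + 1), by positivity⟩ 0 ⟨M, hM0⟩ K := by
      refine IsPicardLindelof.of_time_independent (fun x _ => hM x) hK ?_
      simp only [sub_zero, sub_self, max_eq_left hN, NNReal.coe_zero]
      exact le_rfl
    obtain ⟨u, hu0, hu⟩ := hpl.exists_eq_forall_mem_Icc_hasDerivWithinAt₀
    have hb := hR (N + 1) hN (fun t => χ (u t)) (fun t => hχ0 _) u hu0 hu
    refine ⟨u, hu0, fun t ht => ⟨hb t ht, ?_⟩⟩
    have := hu t ht
    simpa [hχR _ (hb t ht)] using this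
  choose v hv0 hv using hloc
  obtain ⟨K, hK⟩ := (hg.locallyLipschitzOn).exists_lipschitzOnWith_of_compact
    (isCompact_closedBall (0 : E) R)
  have hagree : ∀ N M : ℕ, N ≤ M → Set.EqOn (v N) (v M) (Set.Icc 0 (N + 1)) := by
    intro N M hNM
    have hNM' : (N : ℝ) + 1 ≤ M + 1 := by gcongr
    have hsub : Set.Icc (0 : ℝ) (N + 1) ⊆ Set.Icc 0 (M + 1) := Set.Icc_subset_Icc_right hNM'
    refine ODE_solution_unique_of_mem_Icc_right (v := fun _ => g)
      (s := fun _ => Metric.closedBall 0 R) (fun _ _ => hK)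
      (fun t ht => (hv N t ht).2.continuousWithinAt)
      (fun t ht => ((hv N t (Set.Ico_subset_Icc_self ht)).2).mono_of_mem_nhdsWithin
        (Icc_mem_nhdsGE_of_mem ht))
      (fun t ht => by simpa using (hv N t (Set.Ico_subset_Icc_self ht)).1)
      (fun t ht => ((hv M t (hsub ht)).2.continuousWithinAt).mono hsub)
      (fun t ht => ((hv M t (hsub (Set.Ico_subset_Icc_self ht))).2).mono_of_mem_nhdsWithin
        (Icc_mem_nhdsGE_of_mem ⟨ht.1, ht.2.trans_le hNM'⟩))
      (fun t ht => by simpa using (hv M t (hsub (Set.Ico_subset_Icc_self ht))).1)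
      (by rw [hv0, hv0])
  refine ⟨fun t => v ⌊t⌋₊ t, by simp [hv0], fun t ht => ?_⟩
  -- The index is one above `⌊t⌋₊`, so that the single solution `v N` agrees with the glued function
  -- on a relative neighbourhood of `t`, even when `t` is an integer.
  set N := ⌊t⌋₊ + 1 with hN
  have htN : t < N := by rw [hN]; exact_mod_cast Nat.lt_floor_add_one t
  have hev : ∀ s : ℝ, 0 ≤ s → s < N → v ⌊s⌋₊ s = v N s := by
    intro s hs hsN
    refine hagree _ _ ?_ ⟨hs, (Nat.lt_floor_add_one s).le⟩
    exact (Nat.floor_lt hs).2 hsN |>.le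
  have hder := (hv N t ⟨ht, by linarith⟩).2
  have hder' : HasDerivWithinAt (v N) (g (v N t)) (Set.Ici 0) t := by
    refine hder.mono_of_mem_nhdsWithin ?_
    filter_upwards [self_mem_nhdsWithin, mem_nhdsWithin_of_mem_nhds (Iio_mem_nhds htN)] with s h1 h2
    exact ⟨h1, by have : s < N := h2; linarith⟩
  simp only [hev t ht htN]
  refine hder'.congr_of_eventuallyEq ?_ (hev t ht htN)
  filter_upwards [self_mem_nhdsWithin, mem_nhdsWithin_of_mem_nhds (Iio_mem_nhds htN)] with s h1 h2
  exact hev s h1 h2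

/-! ### The abstract saddle flow and its Lyapunov function -/

/-- The data of an augmented primal-dual flow in inner product spaces: `F` is the strongly monotone
gradient of the cost, `A x = c` the stacked constraint, `L` the coupling between the multipliers,
and `S` a map annihilating the range of `L`. -/
structure SaddleSystem (X Y W : Type*) [NormedAddCommGroup X] [InnerProductSpace ℝ X]
    [NormedAddCommGroup Y] [InnerProductSpace ℝ Y] [NormedAddCommGroup W] [NormedSpace ℝ W] where
  F : X → X
  A : X →L[ℝ] Y
  L : Y →L[ℝ] Y
  S : Y →L[ℝ] W
  c : Y
  (α β φ μ σ η C : ℝ)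
  F_lip : LocallyLipschitz F
  F_mono : ∀ x y, μ * ‖x - y‖ ^ 2 ≤ ⟪x - y, F x - F y⟫
  A_le : ∀ x, ‖A x‖ ^ 2 ≤ σ ^ 2 * ‖x‖ ^ 2
  S_L : ∀ l, S (L l) = 0
  L_nonneg : ∀ l, 0 ≤ ⟪l, L l⟫
  L_le : ∀ l, ‖L l‖ ^ 2 ≤ C * ⟪l, L l⟫
  L_gap : ∀ l z, S z = 0 → η * ⟪l, z⟫ ^ 2 ≤ ⟪l, L l⟫ * ‖z‖ ^ 2
  μ_pos : 0 < μ
  η_pos : 0 < η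
  α_pos : 0 < α
  φ_pos : 0 < φ
  α_ge : (φ ^ 2 + 3 * φ + 3) * σ ^ 2 ≤ α * ((φ + 1) * μ)
  β_ge : (φ + 1) ^ 2 * α ≤ β * (φ * η)

namespace SaddleSystem

variable {X Y W : Type*} [NormedAddCommGroup X] [InnerProductSpace ℝ X] [FiniteDimensional ℝ X]
  [NormedAddCommGroup Y] [InnerProductSpace ℝ Y] [FiniteDimensional ℝ Y]
  [NormedAddCommGroup W] [NormedSpace ℝ W] (D : SaddleSystem X Y W)

/-- The adjoint of the constraint map. -/
noncomputable def At : Y →L[ℝ] X := LinearMap.toContinuousLinearMap (LinearMap.adjoint D.A.toLinearMap)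

theorem inner_At (x : X) (y : Y) : ⟪x, D.At y⟫ = ⟪D.A x, y⟫ := by
  simp [At, LinearMap.adjoint_inner_right]

theorem β_pos : 0 < D.β := by
  have h := D.β_ge
  have h1 := D.α_pos
  have h2 := D.φ_pos
  have h3 := D.η_pos
  by_contra hb
  have : D.β * (D.φ * D.η) ≤ 0 := mul_nonpos_of_nonpos_of_nonneg (not_lt.1 hb) (by positivity)
  have : 0 < (D.φ + 1) ^ 2 * D.α := by positivity
  linarith

/-- The constraint residual. -/
def res (s : X × Y × Y) : Y := D.A s.1 - D.c - s.2.2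

/-- The vector field of the flow. -/
noncomputable def field (s : X × Y × Y) : X × Y × Y :=
  (-(D.α • (D.F s.1 + D.At s.2.1)) - D.At (D.res s), D.res s - D.β • D.L s.2.1,
    (D.α * D.β) • D.L s.2.1)

/-- An equilibrium, expressed through the optimality conditions. -/
structure IsEquilibrium (e : X × Y × Y) : Prop where
  stationary : D.F e.1 + D.At e.2.1 = 0
  residual : D.res e = 0
  consensus : D.L e.2.1 = 0

theorem IsEquilibrium.field_eq_zero {D : SaddleSystem X Y W} {e : X × Y × Y}
    (he : D.IsEquilibrium e) : D.field e = 0 := by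
  simp [field, he.stationary, he.residual, he.consensus]

theorem field_locallyLipschitz : LocallyLipschitz D.field := by
  have h1 : LocallyLipschitz fun s : X × Y × Y => (D.F s.1, s) :=
    (D.F_lip.comp LipschitzWith.prod_fst.locallyLipschitz).prodMk LocallyLipschitz.id
  have h2 : ContDiff ℝ 1 fun p : X × X × Y × Y =>
      (-(D.α • (p.1 + D.At p.2.2.1)) - D.At (D.A p.2.1 - D.c - p.2.2.2),
        D.A p.2.1 - D.c - p.2.2.2 - D.β • D.L p.2.2.1, (D.α * D.β) • D.L p.2.2.1) := by
    fun_prop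
  exact h2.locallyLipschitz.comp h1

/-- The Lyapunov function centred at `e`. -/
noncomputable def lyapunov (e s : X × Y × Y) : ℝ :=
  (1 / 2) * ((D.φ + 1) * ‖s.1 - e.1‖ ^ 2
    + (1 / D.α) * ‖D.α • (s.2.1 - e.2.1) + (s.2.2 - e.2.2)‖ ^ 2
    + (D.α * D.φ) * ‖s.2.1 - e.2.1‖ ^ 2)

/-- The derivative of the Lyapunov function in the direction of `v`. -/
noncomputable def lyapunovDeriv (e s v : X × Y × Y) : ℝ :=
  (D.φ + 1) * ⟪s.1 - e.1, v.1⟫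
    + (1 / D.α) * ⟪D.α • (s.2.1 - e.2.1) + (s.2.2 - e.2.2), D.α • v.2.1 + v.2.2⟫
    + (D.α * D.φ) * ⟪s.2.1 - e.2.1, v.2.1⟫

/-- The rate at which the Lyapunov function decreases. -/
noncomputable def dissipation (e s : X × Y × Y) : ℝ :=
  D.α * (D.φ + 1) * D.μ / 3 * ‖s.1 - e.1‖ ^ 2 + ‖s.2.2 - e.2.2‖ ^ 2 / 8
    + D.α * D.φ * D.β / 2 * ⟪s.2.1 - e.2.1, D.L (s.2.1 - e.2.1)⟫

theorem dissipation_nonneg (e s : X × Y × Y) : 0 ≤ D.dissipation e s := by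
  have h1 := D.α_pos
  have h2 := D.φ_pos
  have h3 := D.μ_pos
  have h4 := D.β_pos
  have h5 := D.L_nonneg (s.2.1 - e.2.1)
  unfold dissipation
  positivity

/-- Subtracting the equilibrium conditions removes `c` and leaves only increments, so all later
estimates can be made in deviations from `e`. -/
theorem field_eq_of_isEquilibrium {e : X × Y × Y} (he : D.IsEquilibrium e) (s : X × Y × Y) :
    D.field s = (-(D.α • (D.F s.1 - D.F e.1 + D.At (s.2.1 - e.2.1)))
        - D.At (D.A (s.1 - e.1) - (s.2.2 - e.2.2)),
      D.A (s.1 - e.1) - (s.2.2 - e.2.2) - D.β • D.L (s.2.1 - e.2.1),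
      (D.α * D.β) • D.L (s.2.1 - e.2.1)) := by
  have h1 : D.res s = D.A (s.1 - e.1) - (s.2.2 - e.2.2) := by
    rw [← sub_zero (D.res s), ← he.residual, res, res, map_sub]; abel
  have h2 : D.F s.1 + D.At s.2.1 = D.F s.1 - D.F e.1 + D.At (s.2.1 - e.2.1) := by
    rw [← sub_zero (D.F s.1 + D.At s.2.1), ← he.stationary, map_sub]; abel
  have h3 : D.L s.2.1 = D.L (s.2.1 - e.2.1) := by rw [map_sub, he.consensus, sub_zero]
  rw [field, h1, h2, h3]

/-- The scalar bookkeeping of the decay, with `p = ⟪x, h⟫`, `xx = ‖x‖²`, `a = ‖A x‖²`, `m = ⟪z, A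
x⟫`, `zz = ‖z‖²`, `l = ⟪λ, z⟫`, `q = ⟪λ, L λ⟫` in deviations and `h` the gradient increment. Of the
available `zz`, one half pays for `l` and three eighths for `m`, leaving one eighth. Half of the `q`
term pays for `l`. Two thirds of the monotonicity term pay for the remaining multiple of `a`. -/
theorem dissipation_estimate {α β φ μ σ η p xx a m zz l q : ℝ} (hα : 0 < α)
    (hφ : 0 < φ) (hη : 0 < η)
    (hα' : (φ ^ 2 + 3 * φ + 3) * σ ^ 2 ≤ α * ((φ + 1) * μ))
    (hβ : (φ + 1) ^ 2 * α ≤ β * (φ * η)) (hxx : 0 ≤ xx) (ha : 0 ≤ a) (hzz : 0 ≤ zz) (hq : 0 ≤ q)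
    (hp : μ * xx ≤ p) (hax : a ≤ σ ^ 2 * xx) (hm : m ^ 2 ≤ zz * a) (hl : η * l ^ 2 ≤ q * zz) :
    -(α * (φ + 1) * p) - (φ + 1) * a + (φ + 2) * m - zz - α * (φ + 1) * l - α * φ * β * q
      ≤ -(α * (φ + 1) * μ / 3 * xx + zz / 8 + α * φ * β / 2 * q) := by
  have hβ0 : 0 < β := by
    by_contra hb
    have : β * (φ * η) ≤ 0 := mul_nonpos_of_nonpos_of_nonneg (not_lt.1 hb) (by positivity)
    have : 0 < (φ + 1) ^ 2 * α := by positivity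
    linarith
  have h1 : |α * (φ + 1) * l| ≤ (α * φ * β * q + zz) / 2 := by
    apply abs_le_of_sq_le_sq _ (by positivity)
    have h2 : (α * (φ + 1) * l) ^ 2 ≤ (α * φ * β * q) * zz := by
      have : (α * (φ + 1) * l) ^ 2 * η ≤ (α * φ * β * q) * zz * η := by
        calc (α * (φ + 1) * l) ^ 2 * η = α ^ 2 * (φ + 1) ^ 2 * (η * l ^ 2) := by ring
          _ ≤ α ^ 2 * (φ + 1) ^ 2 * (q * zz) := by gcongr
          _ = α * (q * zz) * ((φ + 1) ^ 2 * α) := by ring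
          _ ≤ α * (q * zz) * (β * (φ * η)) := by gcongr
          _ = _ := by ring
      exact le_of_mul_le_mul_right this hη
    nlinarith [sq_nonneg (α * φ * β * q - zz)]
  -- Young's inequality with weights of product 1/4. After subtracting `(φ + 1) * a`, the
  -- coefficient of `a` is at most `2 / 3 * (φ ^ 2 + 3 * φ + 3)`, which is what the bound on `α`
  -- handles.
  have h2 : (φ + 2) * m ≤ 3 / 8 * zz + 2 / 3 * ((φ + 2) ^ 2 * a) := by
    apply le_of_abs_le
    apply abs_le_of_sq_le_sq _ (by positivity)
    have : ((φ + 2) * m) ^ 2 ≤ zz * ((φ + 2) ^ 2 * a) := by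
      calc ((φ + 2) * m) ^ 2 = (φ + 2) ^ 2 * m ^ 2 := by ring
        _ ≤ (φ + 2) ^ 2 * (zz * a) := by gcongr
        _ = _ := by ring
    nlinarith [sq_nonneg (3 / 8 * zz - 2 / 3 * ((φ + 2) ^ 2 * a))]
  have h3 : (φ ^ 2 + 3 * φ + 3) * a ≤ α * ((φ + 1) * μ) * xx := by
    calc (φ ^ 2 + 3 * φ + 3) * a ≤ (φ ^ 2 + 3 * φ + 3) * (σ ^ 2 * xx) := by gcongr
      _ = (φ ^ 2 + 3 * φ + 3) * σ ^ 2 * xx := by ring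
      _ ≤ _ := by gcongr
  have h4 : α * (φ + 1) * (μ * xx) ≤ α * (φ + 1) * p := by gcongr
  have h5 : -(α * (φ + 1) * l) ≤ |α * (φ + 1) * l| := neg_le_abs _
  have h6 : 0 ≤ φ * a := by positivity
  linarith

/-- With weights `φ + 1`, `1 / α` and `α * φ`, the three contributions to `⟪l, A x⟫` are `-α (φ +
1)`, `α` and `α φ`, which add up to zero. -/
theorem lyapunovDeriv_field_le {e : X × Y × Y} (he : D.IsEquilibrium e) (s : X × Y × Y)
    (hs : D.S (s.2.2 - e.2.2) = 0) :
    D.lyapunovDeriv e s (D.field s) ≤ -D.dissipation e s := by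
  have hα := D.α_pos
  have hφ := D.φ_pos
  rw [D.field_eq_of_isEquilibrium he]
  obtain ⟨x, l, z⟩ := s
  obtain ⟨x', l', z'⟩ := e
  have hmono := D.F_mono x x'
  simp only [lyapunovDeriv, dissipation] at hs ⊢
  set h := D.F x - D.F x'
  generalize x - x' = x at *
  generalize l - l' = l at *
  generalize z - z' = z at *
  -- The combination `α λ + z` is chosen so that the Laplacian drops out of its derivative.
  have e1 : D.α • (D.A x - z - D.β • D.L l) + (D.α * D.β) • D.L l = D.α • (D.A x - z) := by
    rw [smul_sub _ (D.A x - z), smul_smul]; abel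
  have key : (D.φ + 1) * ⟪x, -(D.α • (h + D.At l)) - D.At (D.A x - z)⟫
      + 1 / D.α * ⟪D.α • l + z, D.α • (D.A x - z)⟫
      + D.α * D.φ * ⟪l, D.A x - z - D.β • D.L l⟫
      = -(D.α * (D.φ + 1) * ⟪x, h⟫) - (D.φ + 1) * ‖D.A x‖ ^ 2 + (D.φ + 2) * ⟪z, D.A x⟫
        - ‖z‖ ^ 2 - D.α * (D.φ + 1) * ⟪l, z⟫ - D.α * D.φ * D.β * ⟪l, D.L l⟫ := by
    simp only [inner_sub_right, inner_add_right, inner_neg_right, inner_smul_right, inner_add_left,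
      inner_smul_left, inner_At, real_inner_self_eq_norm_sq, real_inner_comm z (D.A x),
      real_inner_comm l (D.A x), map_sub, RCLike.conj_to_real]
    field_simp
    ring
  rw [e1, key]
  refine dissipation_estimate hα hφ D.η_pos D.α_ge D.β_ge (sq_nonneg _) (sq_nonneg _) (sq_nonneg _)
    (D.L_nonneg l) hmono (D.A_le x) ?_ (D.L_gap l z hs)
  have := abs_real_inner_le_norm z (D.A x)
  rw [← sq_abs, ← mul_pow]
  gcongr

theorem hasDerivWithinAt_components {u : ℝ → X × Y × Y} {v : X × Y × Y} {T : Set ℝ} {t : ℝ}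
    (hu : HasDerivWithinAt u v T t) :
    HasDerivWithinAt (fun t => (u t).1) v.1 T t ∧ HasDerivWithinAt (fun t => (u t).2.1) v.2.1 T t ∧
      HasDerivWithinAt (fun t => (u t).2.2) v.2.2 T t :=
  ⟨(ContinuousLinearMap.fst ℝ X (Y × Y)).hasFDerivAt.comp_hasDerivWithinAt t hu,
    (ContinuousLinearMap.fst ℝ Y Y ∘L ContinuousLinearMap.snd ℝ X (Y × Y)).hasFDerivAt
      |>.comp_hasDerivWithinAt t hu,
    (ContinuousLinearMap.snd ℝ Y Y ∘L ContinuousLinearMap.snd ℝ X (Y × Y)).hasFDerivAt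
      |>.comp_hasDerivWithinAt t hu⟩

theorem hasDerivWithinAt_lyapunov {u : ℝ → X × Y × Y} {v : X × Y × Y} {T : Set ℝ} {t : ℝ}
    (hu : HasDerivWithinAt u v T t) (e : X × Y × Y) :
    HasDerivWithinAt (fun t => D.lyapunov e (u t)) (D.lyapunovDeriv e (u t) v) T t := by
  obtain ⟨h1, h2, h3⟩ := hasDerivWithinAt_components hu
  have d1 := ((h1.sub_const e.1).norm_sq).const_mul (D.φ + 1)
  have d2 := ((((h2.sub_const e.2.1).const_smul D.α).add (h3.sub_const e.2.2)).norm_sq).const_mul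
    (1 / D.α)
  have d3 := ((h2.sub_const e.2.1).norm_sq).const_mul (D.α * D.φ)
  have := ((d1.add d2).add d3).const_mul (1 / 2)
  refine this.congr_deriv ?_
  simp only [lyapunovDeriv, Pi.add_apply, Pi.smul_apply]
  ring

theorem antitoneOn_of_hasDerivWithinAt_self {f f' : ℝ → ℝ} {T : Set ℝ} (hT : Convex ℝ T)
    (hf : ∀ t ∈ T, HasDerivWithinAt f (f' t) T t) (h : ∀ t ∈ T, f' t ≤ 0) : AntitoneOn f T :=
  antitoneOn_of_hasDerivWithinAt_nonpos hT (fun t ht => (hf t ht).continuousWithinAt)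
    (fun t ht => (hf t (interior_subset ht)).mono interior_subset)
    (fun t ht => h t (interior_subset ht))

/-- `S z` is conserved along damped trajectories. -/
theorem S_conserved {u : ℝ → X × Y × Y} {T : Set ℝ} (hT : Convex ℝ T) (h0 : (0 : ℝ) ∈ T)
    {θ : ℝ → ℝ} (hu : ∀ t ∈ T, HasDerivWithinAt u (θ t • D.field (u t)) T t) {t : ℝ} (ht : t ∈ T) :
    D.S (u t).2.2 = D.S (u 0).2.2 := by
  have hd : ∀ t ∈ T, HasDerivWithinAt (fun t => D.S (u t).2.2) 0 T t := by
    intro t ht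
    have := D.S.hasFDerivAt.comp_hasDerivWithinAt t (hasDerivWithinAt_components (hu t ht)).2.2
    have h0 : D.S (θ t • D.field (u t)).2.2 = 0 := by simp [field, D.S_L]
    rwa [h0] at this
  have := hT.norm_image_sub_le_of_norm_hasDerivWithin_le (C := 0) hd (by simp) h0 ht
  simpa [sub_eq_zero] using this

/-- The Lyapunov function decreases along damped trajectories. -/
theorem lyapunov_antitoneOn {u : ℝ → X × Y × Y} {T : Set ℝ} (hT : Convex ℝ T) (h0 : (0 : ℝ) ∈ T)
    {θ : ℝ → ℝ} (hθ : ∀ t, 0 ≤ θ t)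
    (hu : ∀ t ∈ T, HasDerivWithinAt u (θ t • D.field (u t)) T t)
    {e : X × Y × Y} (he : D.IsEquilibrium e) (hS : D.S (u 0).2.2 = D.S e.2.2) :
    AntitoneOn (fun t => D.lyapunov e (u t)) T := by
  refine antitoneOn_of_hasDerivWithinAt_self hT
    (fun t ht => D.hasDerivWithinAt_lyapunov (hu t ht) e) fun t ht => ?_
  have h1 : D.S ((u t).2.2 - e.2.2) = 0 := by
    rw [map_sub, D.S_conserved hT h0 hu ht, hS, sub_self]
  have h2 := D.lyapunovDeriv_field_le he (u t) h1
  have h3 := D.dissipation_nonneg e (u t)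
  have h4 : D.lyapunovDeriv e (u t) (θ t • D.field (u t))
      = θ t * D.lyapunovDeriv e (u t) (D.field (u t)) := by
    simp only [lyapunovDeriv, Prod.smul_fst, Prod.smul_snd, smul_comm D.α (θ t), ← smul_add,
      inner_smul_right]
    ring
  rw [h4]
  exact mul_nonpos_of_nonneg_of_nonpos (hθ t) (by linarith)

/-- Sublevel sets of the Lyapunov function are bounded. -/
theorem norm_sub_sq_le_lyapunov (e : X × Y × Y) :
    ∃ K, 0 ≤ K ∧ ∀ s, ‖s - e‖ ^ 2 ≤ K * D.lyapunov e s := by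
  have hα := D.α_pos
  have hφ := D.φ_pos
  -- The three summands bound the `x`, `λ` and `z` parts respectively; the product carries the sup
  -- norm, so one of them always suffices.
  refine ⟨2 + 2 / (D.α * D.φ) + (4 * D.α + 4 * D.α / D.φ), by positivity, fun s => ?_⟩
  set x := s.1 - e.1 with hx
  set l := s.2.1 - e.2.1 with hl
  set z := s.2.2 - e.2.2 with hz
  set V := D.lyapunov e s with hV
  have hV' : V = (1 / 2) * ((D.φ + 1) * ‖x‖ ^ 2 + (1 / D.α) * ‖D.α • l + z‖ ^ 2
    + (D.α * D.φ) * ‖l‖ ^ 2) := rfl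
  have p1 : 0 ≤ D.φ * ‖x‖ ^ 2 := by positivity
  have p2 : 0 ≤ (1 / D.α) * ‖D.α • l + z‖ ^ 2 := by positivity
  have p3 : 0 ≤ (D.α * D.φ) * ‖l‖ ^ 2 := by positivity
  have p4 : 0 ≤ ‖x‖ ^ 2 := by positivity
  have hV0 : 0 ≤ V := by rw [hV']; linarith
  have b1 : ‖x‖ ^ 2 ≤ 2 * V := by linarith
  have b2 : ‖l‖ ^ 2 ≤ 2 / (D.α * D.φ) * V := by
    rw [div_mul_eq_mul_div, le_div_iff₀ (by positivity)]
    linarith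
  have b3 : ‖D.α • l + z‖ ^ 2 ≤ 2 * D.α * V := by
    have : (1 / D.α) * ‖D.α • l + z‖ ^ 2 ≤ 2 * V := by linarith
    rw [one_div, inv_mul_le_iff₀ hα] at this
    linarith
  have b4 : ‖z‖ ^ 2 ≤ (4 * D.α + 4 * D.α / D.φ) * V := by
    have h1 : ‖z‖ ≤ ‖D.α • l + z‖ + D.α * ‖l‖ := by
      have := norm_sub_le (D.α • l + z) (D.α • l)
      rwa [add_sub_cancel_left, norm_smul, Real.norm_of_nonneg hα.le] at this
    calc ‖z‖ ^ 2 ≤ (‖D.α • l + z‖ + D.α * ‖l‖) ^ 2 := by gcongr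
      _ ≤ 2 * (‖D.α • l + z‖ ^ 2 + (D.α * ‖l‖) ^ 2) := add_sq_le
      _ = 2 * ‖D.α • l + z‖ ^ 2 + 2 * D.α ^ 2 * ‖l‖ ^ 2 := by ring
      _ ≤ 2 * (2 * D.α * V) + 2 * D.α ^ 2 * (2 / (D.α * D.φ) * V) := by gcongr
      _ = _ := by field_simp; ring
  have q1 : 0 ≤ 2 / (D.α * D.φ) * V := by positivity
  have q2 : 0 ≤ (4 * D.α + 4 * D.α / D.φ) * V := by positivity
  have hn : ‖s - e‖ = max ‖x‖ (max ‖l‖ ‖z‖) := by rw [Prod.norm_def, Prod.norm_def]; rfl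
  rw [hn, add_mul, add_mul]
  rcases max_choice ‖x‖ (max ‖l‖ ‖z‖) with h | h <;> rw [h]
  · linarith
  · rcases max_choice ‖l‖ ‖z‖ with h | h <;> rw [h] <;> linarith

/-! ### The cross term and strict decay -/

/-- The cross term `⟪A (x - x'), l - l'⟫`, which makes `Aᵀ (l - l')` visible. -/
noncomputable def cross (e s : X × Y × Y) : ℝ := ⟪D.A (s.1 - e.1), s.2.1 - e.2.1⟫

/-- The derivative of the cross term in the direction of `v`. -/
noncomputable def crossDeriv (e s v : X × Y × Y) : ℝ :=
  ⟪D.A (s.1 - e.1), v.2.1⟫ + ⟪D.A v.1, s.2.1 - e.2.1⟫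

theorem hasDerivWithinAt_cross {u : ℝ → X × Y × Y} {v : X × Y × Y} {T : Set ℝ} {t : ℝ}
    (hu : HasDerivWithinAt u v T t) (e : X × Y × Y) :
    HasDerivWithinAt (fun t => D.cross e (u t)) (D.crossDeriv e (u t) v) T t := by
  obtain ⟨h1, h2, -⟩ := hasDerivWithinAt_components hu
  exact (D.A.hasFDerivAt.comp_hasDerivWithinAt t (h1.sub_const e.1)).inner ℝ (h2.sub_const e.2.1)

/-- The term `⟪A x', λ⟫ = ⟪x', Aᵀ λ⟫`, with `x'` the velocity, produces `-α ‖Aᵀ λ‖²`. Young's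
inequality spends a quarter of `α ‖Aᵀ λ‖²` on the gradient increment and a quarter on `Aᵀ r`.
Everything else is bounded by quantities that the dissipation controls. -/
theorem crossDeriv_field_le {e : X × Y × Y} (he : D.IsEquilibrium e) {K : ℝ} (s : X × Y × Y)
    (hK : ‖D.F s.1 - D.F e.1‖ ≤ K * ‖s.1 - e.1‖) :
    D.crossDeriv e s (D.field s) ≤ -(D.α / 2 * ‖D.At (s.2.1 - e.2.1)‖ ^ 2)
      + ((D.α * K ^ 2 + D.σ ^ 2 + (2 * (‖D.At‖ ^ 2 / D.α) + 1) * D.σ ^ 2) * ‖s.1 - e.1‖ ^ 2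
        + (2 * (‖D.At‖ ^ 2 / D.α) + 1) * ‖s.2.2 - e.2.2‖ ^ 2
        + D.β ^ 2 * |D.C| / 2 * ⟪s.2.1 - e.2.1, D.L (s.2.1 - e.2.1)⟫) := by
  have hα := D.α_pos
  rw [D.field_eq_of_isEquilibrium he]
  obtain ⟨x, l, z⟩ := s
  obtain ⟨x', l', z'⟩ := e
  simp only [crossDeriv] at hK ⊢
  set h := D.F x - D.F x'
  generalize x - x' = x at *
  generalize l - l' = l at *
  generalize z - z' = z at *
  rw [← D.inner_At _ l]
  set y := D.At l
  set r := D.A x - z with hr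
  have e1 : ⟪-(D.α • (h + y)) - D.At r, y⟫ = -(D.α * ⟪h, y⟫) - D.α * ‖y‖ ^ 2 - ⟪D.At r, y⟫ := by
    simp only [inner_sub_left, inner_add_left, inner_neg_left, inner_smul_left,
      real_inner_self_eq_norm_sq, RCLike.conj_to_real]
    ring
  rw [e1, inner_sub_right, inner_smul_right]
  have b1 : -⟪h, y⟫ ≤ ‖y‖ ^ 2 / 4 + K ^ 2 * ‖x‖ ^ 2 := by
    have h1 := (neg_le_abs _).trans (abs_real_inner_le_norm h y)
    have h2 : ‖h‖ ^ 2 ≤ (K * ‖x‖) ^ 2 := by gcongr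
    nlinarith [sq_nonneg (‖h‖ - ‖y‖ / 2)]
  have b2 : -⟪D.At r, y⟫ ≤ D.α / 4 * ‖y‖ ^ 2 + ‖D.At‖ ^ 2 / D.α * ‖r‖ ^ 2 := by
    have h1 := (neg_le_abs _).trans (abs_real_inner_le_norm (D.At r) y)
    have h2 : ‖D.At r‖ ^ 2 ≤ (‖D.At‖ * ‖r‖) ^ 2 := by gcongr; exact D.At.le_opNorm r
    have h3 : ‖D.At r‖ * ‖y‖ ≤ D.α / 4 * ‖y‖ ^ 2 + ‖D.At r‖ ^ 2 / D.α := by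
      have : D.α / 4 * ‖y‖ ^ 2 + ‖D.At r‖ ^ 2 / D.α - ‖D.At r‖ * ‖y‖
          = (D.α * ‖y‖ / 2 - ‖D.At r‖) ^ 2 / D.α := by field_simp; ring
      have : 0 ≤ (D.α * ‖y‖ / 2 - ‖D.At r‖) ^ 2 / D.α := by positivity
      linarith
    have h4 : ‖D.At r‖ ^ 2 / D.α ≤ (‖D.At‖ * ‖r‖) ^ 2 / D.α := by gcongr
    calc _ ≤ _ := h1.trans (h3.trans (add_le_add_right h4 _))
      _ = _ := by ring
  have b3 : ⟪D.A x, r⟫ ≤ ‖D.A x‖ ^ 2 / 2 + ‖r‖ ^ 2 / 2 := by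
    nlinarith [real_inner_le_norm (D.A x) r, sq_nonneg (‖D.A x‖ - ‖r‖)]
  have b4 : -(D.β * ⟪D.A x, D.L l⟫) ≤ ‖D.A x‖ ^ 2 / 2 + D.β ^ 2 * |D.C| / 2 * ⟪l, D.L l⟫ := by
    have h1 := (neg_le_abs _).trans (abs_real_inner_le_norm (D.A x) (D.L l))
    have h2 : D.β * -⟪D.A x, D.L l⟫ ≤ D.β * (‖D.A x‖ * ‖D.L l‖) :=
      mul_le_mul_of_nonneg_left h1 D.β_pos.le
    have h3 : ‖D.L l‖ ^ 2 ≤ |D.C| * ⟪l, D.L l⟫ :=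
      (D.L_le l).trans (mul_le_mul_of_nonneg_right (le_abs_self _) (D.L_nonneg l))
    have h4 : D.β ^ 2 * ‖D.L l‖ ^ 2 ≤ D.β ^ 2 * (|D.C| * ⟪l, D.L l⟫) := by gcongr
    nlinarith [sq_nonneg (‖D.A x‖ - D.β * ‖D.L l‖)]
  have b5 : ‖r‖ ^ 2 ≤ 2 * (‖D.A x‖ ^ 2 + ‖z‖ ^ 2) := by
    have := norm_sub_le (D.A x) z
    calc ‖r‖ ^ 2 ≤ (‖D.A x‖ + ‖z‖) ^ 2 := by gcongr
      _ ≤ _ := add_sq_le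
  have b6 := D.A_le x
  have b7 : (‖D.At‖ ^ 2 / D.α + 1 / 2) * ‖r‖ ^ 2
      ≤ (‖D.At‖ ^ 2 / D.α + 1 / 2) * (2 * (D.σ ^ 2 * ‖x‖ ^ 2 + ‖z‖ ^ 2)) := by
    gcongr
    linarith
  have b8 := mul_le_mul_of_nonneg_left b1 hα.le
  nlinarith

theorem exists_strict_decrease {e : X × Y × Y} (he : D.IsEquilibrium e) (K : ℝ) :
    ∃ ε, 0 < ε ∧ ∀ s, ‖D.F s.1 - D.F e.1‖ ≤ K * ‖s.1 - e.1‖ → D.S (s.2.2 - e.2.2) = 0 →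
      D.lyapunovDeriv e s (D.field s) + ε * D.crossDeriv e s (D.field s)
        ≤ -(D.dissipation e s / 2 + ε * (D.α / 2 * ‖D.At (s.2.1 - e.2.1)‖ ^ 2)) := by
  have hα := D.α_pos
  have hφ := D.φ_pos
  have hμ := D.μ_pos
  have hβ := D.β_pos
  set c₁ := D.α * K ^ 2 + D.σ ^ 2 + (2 * (‖D.At‖ ^ 2 / D.α) + 1) * D.σ ^ 2 with hc₁
  set c₂ := 2 * (‖D.At‖ ^ 2 / D.α) + 1 with hc₂
  set c₃ := D.β ^ 2 * |D.C| / 2 with hc₃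
  have h1 : 0 ≤ c₁ := by positivity
  have h2 : 0 < c₂ := by positivity
  have h3 : 0 ≤ c₃ := by positivity
  set k₁ := D.α * (D.φ + 1) * D.μ / 3 with hk₁
  set k₃ := D.α * D.φ * D.β / 2 with hk₃
  have hk₁' : 0 < k₁ := by positivity
  have hk₃' : 0 < k₃ := by positivity
  -- Each summand compares one error coefficient with its coefficient in the dissipation (the 8
  -- inverts `1 / 8`). With `ε = 1 / (2 * M)` the errors cost half of the dissipation.
  set M := c₁ / k₁ + 8 * c₂ + c₃ / k₃ with hM
  have hMpos : 0 < M := by positivity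
  refine ⟨1 / (2 * M), by positivity, fun s hs hS => ?_⟩
  have d1 := D.lyapunovDeriv_field_le he s hS
  have d2 := D.crossDeriv_field_le he s hs
  rw [← hc₂, ← hc₁, ← hc₃] at d2
  have d3 : c₁ * ‖s.1 - e.1‖ ^ 2 + c₂ * ‖s.2.2 - e.2.2‖ ^ 2
      + c₃ * ⟪s.2.1 - e.2.1, D.L (s.2.1 - e.2.1)⟫ ≤ M * D.dissipation e s := by
    have hq := D.L_nonneg (s.2.1 - e.2.1)
    have m1 : c₁ ≤ M * k₁ := by
      calc c₁ = c₁ / k₁ * k₁ := by field_simp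
        _ ≤ M * k₁ := by gcongr; rw [hM, add_assoc]; exact le_add_of_nonneg_right (by positivity)
    have m2 : c₂ ≤ M * (1 / 8) := by
      have : 0 ≤ c₁ / k₁ := by positivity
      have : 0 ≤ c₃ / k₃ := by positivity
      linarith
    have m3 : c₃ ≤ M * k₃ := by
      calc c₃ = c₃ / k₃ * k₃ := by field_simp
        _ ≤ M * k₃ := by gcongr; exact le_add_of_nonneg_left (by positivity)
    calc _ ≤ (M * k₁) * ‖s.1 - e.1‖ ^ 2 + (M * (1 / 8)) * ‖s.2.2 - e.2.2‖ ^ 2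
          + (M * k₃) * ⟪s.2.1 - e.2.1, D.L (s.2.1 - e.2.1)⟫ := by gcongr
      _ = _ := by rw [dissipation]; ring
  have d4 : 1 / (2 * M) * D.crossDeriv e s (D.field s)
      ≤ 1 / (2 * M) * (-(D.α / 2 * ‖D.At (s.2.1 - e.2.1)‖ ^ 2) + M * D.dissipation e s) := by
    gcongr
    linarith
  have d5 : 1 / (2 * M) * (M * D.dissipation e s) = D.dissipation e s / 2 := by field_simp
  rw [mul_add (1 / (2 * M)), d5] at d4
  linarith

/-! ### Existence and convergence of trajectories -/

theorem lyapunov_continuous (e : X × Y × Y) : Continuous (D.lyapunov e) := by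
  unfold lyapunov; fun_prop

theorem lyapunov_self (e : X × Y × Y) : D.lyapunov e e = 0 := by simp [lyapunov]

/-- Trajectories of the flow exist globally. -/
theorem exists_trajectory {e : X × Y × Y} (he : D.IsEquilibrium e) (s₀ : X × Y × Y)
    (hS : D.S s₀.2.2 = D.S e.2.2) :
    ∃ u : ℝ → X × Y × Y, u 0 = s₀ ∧ ∀ t, 0 ≤ t → HasDerivWithinAt u (D.field (u t)) (Set.Ici 0) t := by
  obtain ⟨K, hK0, hK⟩ := D.norm_sub_sq_le_lyapunov e
  refine exists_forall_nonneg_hasDerivWithinAt D.field_locallyLipschitz s₀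
    (√(K * D.lyapunov e s₀) + ‖e‖) fun T hT θ hθ u hu0 hu t ht => ?_
  have h0 : (0 : ℝ) ∈ Set.Icc 0 T := ⟨le_rfl, hT⟩
  have h1 := D.lyapunov_antitoneOn (convex_Icc 0 T) h0 hθ hu he (by rw [hu0, hS]) h0 ht ht.1
  simp only [hu0] at h1
  have h2 : ‖u t - e‖ ≤ √(K * D.lyapunov e s₀) :=
    Real.le_sqrt_of_sq_le ((hK (u t)).trans (mul_le_mul_of_nonneg_left h1 hK0))
  have h3 := norm_add_le (u t - e) e
  rw [sub_add_cancel] at h3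
  linarith

/-- Every trajectory of the flow converges to an equilibrium with the same primal part. -/
theorem exists_tendsto {e : X × Y × Y} (he : D.IsEquilibrium e) {u : ℝ → X × Y × Y}
    (hS : D.S (u 0).2.2 = D.S e.2.2)
    (hu : ∀ t, 0 ≤ t → HasDerivWithinAt u (D.field (u t)) (Set.Ici 0) t) :
    ∃ e', D.IsEquilibrium e' ∧ e'.1 = e.1 ∧ Tendsto u atTop (𝓝 e') := by
  have hα := D.α_pos
  have h0 : (0 : ℝ) ∈ Set.Ici (0 : ℝ) := Set.self_mem_Ici
  have hu1 : ∀ t ∈ Set.Ici (0 : ℝ),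
      HasDerivWithinAt u ((fun _ : ℝ => (1 : ℝ)) t • D.field (u t)) (Set.Ici 0) t := by
    intro t ht
    simpa using hu t ht
  obtain ⟨K, hK0, hK⟩ := D.norm_sub_sq_le_lyapunov e
  set R := √(K * D.lyapunov e (u 0)) with hR
  have hball : ∀ t, 0 ≤ t → u t ∈ Metric.closedBall e R := by
    intro t ht
    rw [mem_closedBall_iff_norm]
    refine Real.le_sqrt_of_sq_le ((hK (u t)).trans (mul_le_mul_of_nonneg_left ?_ hK0))
    exact D.lyapunov_antitoneOn (convex_Ici 0) h0 (fun _ => zero_le_one) hu1 he hS h0 ht ht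
  have hcomp := isCompact_closedBall e R
  -- `F` is only locally Lipschitz; confinement to a compact ball gives the constant from which `ε`
  -- is chosen.
  obtain ⟨k, hk⟩ := (D.F_lip.locallyLipschitzOn).exists_lipschitzOnWith_of_compact
    (isCompact_closedBall e.1 R)
  have hF : ∀ t, 0 ≤ t → ‖D.F (u t).1 - D.F e.1‖ ≤ k * ‖(u t).1 - e.1‖ := by
    intro t ht
    have h1 := mem_closedBall_iff_norm.1 (hball t ht)
    have h2 : ‖(u t).1 - e.1‖ ≤ R := (norm_fst_le (u t - e)).trans h1
    have := hk.dist_le_mul (u t).1 (mem_closedBall_iff_norm.2 h2) e.1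
      (Metric.mem_closedBall_self ((norm_nonneg _).trans h1))
    rwa [dist_eq_norm, dist_eq_norm] at this
  obtain ⟨ε, hε, hdec⟩ := D.exists_strict_decrease he k
  set w : X × Y × Y → ℝ := fun s =>
    D.dissipation e s / 2 + ε * (D.α / 2 * ‖D.At (s.2.1 - e.2.1)‖ ^ 2) with hw
  have hwc : Continuous w := by
    simp only [hw, dissipation]; fun_prop
  have hw0 : ∀ s, 0 ≤ w s := by
    intro s
    have := D.dissipation_nonneg e s
    simp only [hw]
    positivity
  set ψ : X × Y × Y → ℝ := fun s => D.lyapunov e s + ε * D.cross e s with hψ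
  have hψc : Continuous ψ := by
    simp only [hψ, lyapunov, cross]; fun_prop
  have hψd : ∀ t, 0 ≤ t → ∃ d, HasDerivWithinAt (fun t => ψ (u t)) d (Set.Ici 0) t ∧ d ≤ -w (u t) := by
    intro t ht
    refine ⟨_, (D.hasDerivWithinAt_lyapunov (hu t ht) e).add
      ((D.hasDerivWithinAt_cross (hu t ht) e).const_mul ε), hdec (u t) (hF t ht) ?_⟩
    rw [map_sub, D.S_conserved (convex_Ici 0) h0 hu1 ht, hS, sub_self]
  obtain ⟨B, hB⟩ := hcomp.exists_bound_of_continuousOn hψc.continuousOn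
  -- If `w` exceeded `δ` at all times from `n` on, `ψ` would fall at rate at least `δ`,
  -- contradicting `|ψ| ≤ B`. The time `T` below makes the fall `2 * B + 1`.
  have hsmall : ∀ n : ℕ, ∃ t : ℝ, n ≤ t ∧ w (u t) ≤ 1 / ((n : ℝ) + 1) := by
    intro n
    by_contra! hcon
    set δ := 1 / ((n : ℝ) + 1) with hδ
    have hδ0 : 0 < δ := by positivity
    have hn0 : (0 : ℝ) ≤ n := by positivity
    have hd : ∀ t ∈ Set.Ici (n : ℝ), ∃ d,
        HasDerivWithinAt (fun t => ψ (u t) + δ * t) d (Set.Ici (n : ℝ)) t ∧ d ≤ 0 := by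
      intro t ht
      obtain ⟨d, h1, h2⟩ := hψd t (hn0.trans ht)
      refine ⟨_, (h1.mono (Set.Ici_subset_Ici.2 hn0)).add
        ((hasDerivWithinAt_id t _).const_mul δ), ?_⟩
      have := hcon t ht
      linarith
    choose! d hd1 hd2 using hd
    have hanti := antitoneOn_of_hasDerivWithinAt_self (convex_Ici _) hd1 hd2
    set T := (n : ℝ) + (2 * B + 1) / δ with hT
    have hB0 : 0 ≤ B := (norm_nonneg _).trans (hB _ (hball 0 le_rfl))
    have hnT : (n : ℝ) ≤ T := le_add_of_nonneg_right (by positivity)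
    have h1 := hanti (Set.self_mem_Ici) (Set.mem_Ici.2 hnT) hnT
    have h2 := abs_le.1 (hB _ (hball T (hn0.trans hnT)))
    have h3 := abs_le.1 (hB _ (hball n hn0))
    have h4 : δ * T = δ * n + (2 * B + 1) := by rw [hT]; field_simp
    simp only [h4] at h1
    linarith [h2.1, h3.2]
  choose τ hτ hτw using hsmall
  have hτ0 : ∀ n, 0 ≤ τ n := fun n => (Nat.cast_nonneg n).trans (hτ n)
  obtain ⟨e', -, ι, hι, hlim⟩ := hcomp.tendsto_subseq (fun n => hball (τ n) (hτ0 n))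
  have hwe : w e' = 0 := by
    refine le_antisymm (le_of_tendsto_of_tendsto ((hwc.tendsto e').comp hlim)
      (tendsto_one_div_add_atTop_nhds_zero_nat.comp hι.tendsto_atTop)
      (Eventually.of_forall fun n => hτw (ι n))) (hw0 e')
  have hd0 := D.dissipation_nonneg e e'
  have hat0 : 0 ≤ ε * (D.α / 2 * ‖D.At (e'.2.1 - e.2.1)‖ ^ 2) := by positivity
  have hd : D.dissipation e e' = 0 := by simp only [hw] at hwe; linarith
  have hat : ε * (D.α / 2 * ‖D.At (e'.2.1 - e.2.1)‖ ^ 2) = 0 := by simp only [hw] at hwe; linarith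
  have hat' : D.At (e'.2.1 - e.2.1) = 0 := by
    simpa [hε.ne', hα.ne'] using hat
  obtain ⟨hx, hz, hq⟩ : e'.1 - e.1 = 0 ∧ e'.2.2 - e.2.2 = 0
      ∧ ⟪e'.2.1 - e.2.1, D.L (e'.2.1 - e.2.1)⟫ = 0 := by
    have hφ := D.φ_pos
    have hμ := D.μ_pos
    have hβ := D.β_pos
    have h5 := D.L_nonneg (e'.2.1 - e.2.1)
    have i1 : 0 ≤ D.α * (D.φ + 1) * D.μ / 3 * ‖e'.1 - e.1‖ ^ 2 := by positivity
    have i2 : 0 ≤ ‖e'.2.2 - e.2.2‖ ^ 2 / 8 := by positivity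
    have i3 : 0 ≤ D.α * D.φ * D.β / 2 * ⟪e'.2.1 - e.2.1, D.L (e'.2.1 - e.2.1)⟫ := by positivity
    unfold dissipation at hd
    have j1 : D.α * (D.φ + 1) * D.μ / 3 * ‖e'.1 - e.1‖ ^ 2 = 0 := by linarith
    have j2 : ‖e'.2.2 - e.2.2‖ ^ 2 / 8 = 0 := by linarith
    have j3 : D.α * D.φ * D.β / 2 * ⟪e'.2.1 - e.2.1, D.L (e'.2.1 - e.2.1)⟫ = 0 := by linarith
    refine ⟨?_, ?_, ?_⟩
    · have : D.α * (D.φ + 1) * D.μ / 3 ≠ 0 := by positivity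
      simpa [this] using j1
    · simpa using j2
    · exact (mul_eq_zero.1 j3).resolve_left (by positivity)
  -- `L` need not be symmetric, so a vanishing quadratic form does not by itself give `L l = 0`;
  -- `L_le` supplies this.
  have hL : D.L (e'.2.1 - e.2.1) = 0 := by
    have := D.L_le (e'.2.1 - e.2.1)
    rw [hq, mul_zero] at this
    simpa using this.antisymm (sq_nonneg _)
  have hx' := sub_eq_zero.1 hx
  have hz' := sub_eq_zero.1 hz
  have he' : D.IsEquilibrium e' := by
    refine ⟨?_, ?_, ?_⟩
    · rw [map_sub, sub_eq_zero] at hat'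
      rw [hx', hat', he.stationary]
    · have := he.residual
      rw [res] at this ⊢
      rwa [hx', hz']
    · rw [map_sub, sub_eq_zero] at hL
      rw [hL, he.consensus]
  refine ⟨e', he', hx', ?_⟩
  -- Recentre at the limit point: `e'` has the same `z` as `e`, so the Lyapunov function at `e'`
  -- also decreases, and it is small at the times `τ (ι n)`.
  obtain ⟨K', hK0', hK'⟩ := D.norm_sub_sq_le_lyapunov e'
  have hanti := D.lyapunov_antitoneOn (convex_Ici 0) h0 (fun _ => zero_le_one) hu1 he'
    (by rw [hS, hz'])
  have hVlim : Tendsto (fun n => K' * D.lyapunov e' (u (τ (ι n)))) atTop (𝓝 0) := by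
    have := (((D.lyapunov_continuous e').tendsto e').comp hlim).const_mul K'
    simpa [D.lyapunov_self, Function.comp_def] using this
  rw [Metric.tendsto_atTop]
  intro r hr
  obtain ⟨n, hn⟩ := (hVlim.eventually (gt_mem_nhds (show 0 < r ^ 2 by positivity))).exists
  refine ⟨τ (ι n), fun t ht => ?_⟩
  rw [dist_eq_norm]
  refine lt_of_pow_lt_pow_left₀ 2 hr.le (lt_of_le_of_lt ?_ hn)
  exact (hK' _).trans (mul_le_mul_of_nonneg_left
    (hanti (hτ0 _) ((hτ0 (ι n)).trans ht) ht) hK0')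

/-- Global existence and convergence for a vector field that is linearly conjugate to the flow. -/
theorem exists_and_tendsto_of_conj {E : Type*} [NormedAddCommGroup E] [NormedSpace ℝ E]
    (Ψ : E ≃L[ℝ] X × Y × Y) {g : E → E} (hg : ∀ s, Ψ (g s) = D.field (Ψ s))
    {e : X × Y × Y} (he : D.IsEquilibrium e) (s₀ : E) (hS : D.S (Ψ s₀).2.2 = D.S e.2.2) :
    (∃ u : ℝ → E, u 0 = s₀ ∧ ∀ t, 0 ≤ t → HasDerivWithinAt u (g (u t)) (Set.Ici 0) t) ∧
      ∀ u : ℝ → E, u 0 = s₀ → (∀ t, 0 ≤ t → HasDerivWithinAt u (g (u t)) (Set.Ici 0) t) →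
        ∃ s, g s = 0 ∧ (Ψ s).1 = e.1 ∧ Tendsto u atTop (𝓝 s) := by
  constructor
  · obtain ⟨u, hu0, hu⟩ := D.exists_trajectory he (Ψ s₀) hS
    refine ⟨fun t => Ψ.symm (u t), by simp [hu0], fun t ht => ?_⟩
    have h1 := Ψ.symm.hasFDerivAt.comp_hasDerivWithinAt t (hu t ht)
    have h2 : Ψ.symm (D.field (u t)) = g (Ψ.symm (u t)) := by
      rw [ContinuousLinearEquiv.symm_apply_eq, hg, ContinuousLinearEquiv.apply_symm_apply]
    exact h1.congr_deriv h2
  · intro u hu0 hu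
    have hu' : ∀ t : ℝ, 0 ≤ t →
        HasDerivWithinAt (fun t => Ψ (u t)) (D.field (Ψ (u t))) (Set.Ici 0) t := fun t ht =>
      (Ψ.hasFDerivAt.comp_hasDerivWithinAt t (hu t ht)).congr_deriv (hg (u t))
    obtain ⟨e', he', hx', hlim⟩ := D.exists_tendsto he (by rwa [hu0]) hu'
    obtain ⟨s, rfl⟩ := Ψ.surjective e'
    refine ⟨s, Ψ.injective ?_, hx', Ψ.toHomeomorph.isInducing.tendsto_nhds_iff.2 hlim⟩
    rw [hg, he'.field_eq_zero, map_zero]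

end SaddleSystem

/-! ### Spectral gap and largest singular value -/

namespace LinearMap.IsSymmetric

variable {E : Type*} [NormedAddCommGroup E] [InnerProductSpace ℝ E] [FiniteDimensional ℝ E]
  {T : E →ₗ[ℝ] E} {n : ℕ}

theorem inner_self_apply_eq_sum_eigenvalues (hT : T.IsSymmetric) (hn : Module.finrank ℝ E = n) (v : E) :
    ⟪v, T v⟫ = ∑ i, hT.eigenvalues hn i * ⟪hT.eigenvectorBasis hn i, v⟫ ^ 2 := by
  rw [← (hT.eigenvectorBasis hn).sum_inner_mul_inner v (T v)]
  refine Finset.sum_congr rfl fun i _ => ?_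
  rw [← hT (hT.eigenvectorBasis hn i) v, hT.apply_eigenvectorBasis, RCLike.ofReal_real_eq_id, id_eq,
    inner_smul_left, real_inner_comm v, RCLike.conj_to_real]
  ring

theorem norm_sq_eq_sum_eigenvectorBasis (hT : T.IsSymmetric) (hn : Module.finrank ℝ E = n) (v : E) :
    ‖v‖ ^ 2 = ∑ i, ⟪hT.eigenvectorBasis hn i, v⟫ ^ 2 := by
  rw [← real_inner_self_eq_norm_sq, ← (hT.eigenvectorBasis hn).sum_inner_mul_inner v v]
  refine Finset.sum_congr rfl fun i _ => ?_
  rw [real_inner_comm v]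
  ring

/-- For a positive semidefinite operator with one-dimensional kernel, the second smallest eigenvalue
is a positive spectral gap on the orthogonal complement of the kernel. -/
theorem eigenvalue_gap (hT : T.IsSymmetric) (hn : Module.finrank ℝ E = n) (h2 : 2 ≤ n)
    (hpos : ∀ v, 0 ≤ ⟪v, T v⟫) {o : E} (ho : T o = 0) (ho0 : o ≠ 0)
    (hker : ∀ v, T v = 0 → ∃ c : ℝ, v = c • o) :
    0 < hT.eigenvalues hn ⟨n - 2, by omega⟩ ∧
      ∀ v, ⟪o, v⟫ = 0 → hT.eigenvalues hn ⟨n - 2, by omega⟩ * ‖v‖ ^ 2 ≤ ⟪v, T v⟫ := by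
  set ev := hT.eigenvalues hn with hev
  set e := hT.eigenvectorBasis hn with he
  have hTe : ∀ i, T (e i) = ev i • e i := fun i => hT.apply_eigenvectorBasis hn i
  have hev0 : ∀ i, 0 ≤ ev i := by
    intro i
    have := hpos (e i)
    rwa [hTe, inner_smul_right, real_inner_self_eq_norm_sq, e.orthonormal.1 i, one_pow, mul_one]
      at this
  set a : Fin n := ⟨n - 2, by omega⟩ with ha
  set z : Fin n := ⟨n - 1, by omega⟩ with hz
  have haz : a ≠ z := by rw [ha, hz, Ne, Fin.mk.injEq]; omega
  have hanti : Antitone ev := hT.eigenvalues_antitone hn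
  -- Eigenvalues decrease with the index, so a zero at `n - 2` forces one at `n - 1`: two orthogonal
  -- eigenvectors in a one-dimensional kernel.
  have hpos2 : 0 < ev a := by
    by_contra hcon
    have ha0 : ev a = 0 := le_antisymm (not_lt.1 hcon) (hev0 a)
    have hz0 : ev z = 0 := by
      refine le_antisymm ((hanti ?_).trans ha0.le) (hev0 z)
      rw [ha, hz, Fin.mk_le_mk]; omega
    obtain ⟨c, hc⟩ := hker (e a) (by rw [hTe, ha0, zero_smul])
    obtain ⟨d, hd⟩ := hker (e z) (by rw [hTe, hz0, zero_smul])
    have h0 : ⟪e a, e z⟫ = 0 := e.orthonormal.2 haz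
    rw [hc, hd, inner_smul_left, inner_smul_right, RCLike.conj_to_real] at h0
    have h1 : ⟪o, o⟫ ≠ 0 := inner_self_ne_zero.2 ho0
    rcases mul_eq_zero.1 h0 with h | h
    · exact e.orthonormal.ne_zero a (by rw [hc, h, zero_smul])
    · exact e.orthonormal.ne_zero z (by rw [hd, (mul_eq_zero.1 h).resolve_right h1, zero_smul])
  refine ⟨hpos2, fun v hv => ?_⟩
  have hle : ∀ i, i ≠ z → ev a ≤ ev i := by
    intro i hi
    refine hanti ?_
    have h1 := i.2
    have h2 : (i : ℕ) ≠ n - 1 := fun h => hi (Fin.ext h)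
    rw [ha, Fin.le_def]
    simp only
    omega
  have horth : ∀ i, i ≠ z → ⟪e i, o⟫ = 0 := by
    intro i hi
    have h1 := hT (e i) o
    rw [ho, inner_zero_right, hTe, inner_smul_left, RCLike.conj_to_real] at h1
    exact (mul_eq_zero.1 h1).resolve_left (hpos2.trans_le (hle i hi)).ne'
  -- All other eigenvalues are positive, so the kernel vector is parallel to the last eigenvector; a
  -- vector orthogonal to `o` then has no component there.
  have hoz : o = ⟪e z, o⟫ • e z := by
    conv_lhs => rw [← e.sum_repr' o]
    exact Finset.sum_eq_single z (fun i _ hi => by rw [horth i hi, zero_smul]) (by simp)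
  have hvz : ⟪e z, v⟫ = 0 := by
    rw [hoz, inner_smul_left, RCLike.conj_to_real] at hv
    refine (mul_eq_zero.1 hv).resolve_left fun h => ho0 ?_
    rw [hoz, h, zero_smul]
  rw [hT.inner_self_apply_eq_sum_eigenvalues hn, hT.norm_sq_eq_sum_eigenvectorBasis hn,
    Finset.mul_sum]
  refine Finset.sum_le_sum fun i _ => ?_
  by_cases hi : i = z
  · rw [hi, ← he, hvz]; simp
  · exact mul_le_mul_of_nonneg_right (hle i hi) (sq_nonneg _)

end LinearMap.IsSymmetric

/-- The square of the top singular value is the top eigenvalue of `adjoint T ∘ₗ T`; a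
zero-dimensional domain has no such eigenvalue and is treated apart. -/
theorem LinearMap.norm_apply_sq_le_singularValues {E F : Type*} [NormedAddCommGroup E]
    [InnerProductSpace ℝ E] [FiniteDimensional ℝ E] [NormedAddCommGroup F] [InnerProductSpace ℝ F]
    [FiniteDimensional ℝ F] (T : E →ₗ[ℝ] F) (x : E) :
    ‖T x‖ ^ 2 ≤ T.singularValues 0 ^ 2 * ‖x‖ ^ 2 := by
  rcases Nat.eq_zero_or_pos (Module.finrank ℝ E) with h | h
  · have := Module.finrank_zero_iff.1 h
    simp [Subsingleton.elim x 0]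
  have hS := T.isSymmetric_adjoint_comp_self
  have h1 : ‖T x‖ ^ 2 = ⟪x, (LinearMap.adjoint T ∘ₗ T) x⟫ := by
    rw [LinearMap.comp_apply, LinearMap.adjoint_inner_right, real_inner_self_eq_norm_sq]
  rw [h1, hS.inner_self_apply_eq_sum_eigenvalues rfl, hS.norm_sq_eq_sum_eigenvectorBasis rfl,
    T.sq_singularValues_of_lt rfl h, Finset.mul_sum]
  exact Finset.sum_le_sum fun i _ => mul_le_mul_of_nonneg_right
    (hS.eigenvalues_antitone rfl (Nat.zero_le _)) (sq_nonneg _)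

theorem largestSingularValue_spec {m k : Type*} [Fintype m] [Fintype k] [DecidableEq k]
    (M : Matrix m k ℝ) (x : EuclideanSpace ℝ k) :
    ‖Matrix.toEuclideanLin M x‖ ^ 2 ≤ largestSingularValue M ^ 2 * ‖x‖ ^ 2 :=
  LinearMap.norm_apply_sq_le_singularValues _ x

/-! ### The quadratic form of a weight-balanced Laplacian -/

namespace WeightedDigraph

variable {n : ℕ} {G : WeightedDigraph n}

theorem sum_laplacian_row (G : WeightedDigraph n) (i : Fin n) : ∑ j, G.laplacian i j = 0 := by
  simp [laplacian, Matrix.diagonal_apply, outDegree, Finset.sum_sub_distrib]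

theorem WeightBalanced.sum_laplacian_col (hbal : G.WeightBalanced) (j : Fin n) :
    ∑ i, G.laplacian i j = 0 := by
  have := hbal j
  simp only [inDegree] at this
  simp [laplacian, Matrix.diagonal_apply, Finset.sum_sub_distrib, this]

theorem sum_laplacian_mul (G : WeightedDigraph n) (v : Fin n → ℝ) (i : Fin n) :
    ∑ j, G.laplacian i j * v j = ∑ j, G.weight i j * (v i - v j) := by
  simp [laplacian, Matrix.diagonal_apply, outDegree, sub_mul, mul_sub, Finset.sum_sub_distrib,
    Finset.sum_mul]

/-- Balance gives `∑ a_ij v_j² = ∑ a_ij v_i²`, which is what completing the square needs.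
Nonnegativity and the description of the kernel both follow from this form. -/
theorem WeightBalanced.quadraticForm_laplacian (hbal : G.WeightBalanced) (v : Fin n → ℝ) :
    ∑ i, v i * ∑ j, G.laplacian i j * v j
      = 1 / 2 * ∑ i, ∑ j, G.weight i j * (v i - v j) ^ 2 := by
  have h1 : ∑ i, ∑ j, G.weight i j * v j ^ 2 = ∑ i, ∑ j, G.weight i j * v i ^ 2 := by
    rw [Finset.sum_comm]
    refine Finset.sum_congr rfl fun i _ => ?_
    rw [← Finset.sum_mul, ← Finset.sum_mul]
    exact congrArg (· * v i ^ 2) (hbal i)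
  have h2 : ∀ i j, G.weight i j * (v i - v j) ^ 2
      = 2 * (v i * (G.weight i j * (v i - v j))) + (G.weight i j * v j ^ 2 - G.weight i j * v i ^ 2) :=
    fun i j => by ring
  simp only [sum_laplacian_mul, h2, Finset.sum_add_distrib, Finset.sum_sub_distrib, h1, sub_self,
    add_zero, ← Finset.mul_sum]
  ring

theorem quadraticForm_symLaplacian (G : WeightedDigraph n) (v : Fin n → ℝ) :
    ∑ i, v i * ∑ j, G.symLaplacian i j * v j = ∑ i, v i * ∑ j, G.laplacian i j * v j := by
  have h1 : ∑ i, v i * ∑ j, G.laplacian j i * v j = ∑ i, v i * ∑ j, G.laplacian i j * v j := by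
    simp only [Finset.mul_sum]
    rw [Finset.sum_comm]
    exact Finset.sum_congr rfl fun i _ => Finset.sum_congr rfl fun j _ => by ring
  have h2 : ∀ i, v i * ∑ j, G.symLaplacian i j * v j
      = 1 / 2 * (v i * ∑ j, G.laplacian i j * v j) + 1 / 2 * (v i * ∑ j, G.laplacian j i * v j) := by
    intro i
    simp only [symLaplacian, Matrix.smul_apply, Matrix.add_apply, Matrix.transpose_apply,
      smul_eq_mul, Finset.mul_sum, ← Finset.sum_add_distrib]
    exact Finset.sum_congr rfl fun j _ => by ring
  simp only [h2, Finset.sum_add_distrib, ← Finset.mul_sum, h1]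
  ring

theorem quadraticForm_nonneg (hbal : G.WeightBalanced) (v : Fin n → ℝ) :
    0 ≤ ∑ i, v i * ∑ j, G.laplacian i j * v j := by
  rw [hbal.quadraticForm_laplacian]
  have := G.weight_nonneg
  exact mul_nonneg (by norm_num) (Finset.sum_nonneg fun i _ => Finset.sum_nonneg fun j _ =>
    mul_nonneg (this i j) (sq_nonneg _))

/-- Every term `a_ij (v_i - v_j)²` vanishes, so `v` is constant along edges and hence along directed
paths. -/
theorem StronglyConnected.eq_of_quadraticForm_eq_zero (hconn : G.StronglyConnected)
    (hbal : G.WeightBalanced) {v : Fin n → ℝ} (hv : ∑ i, v i * ∑ j, G.laplacian i j * v j = 0)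
    (i j : Fin n) : v i = v j := by
  rw [hbal.quadraticForm_laplacian] at hv
  have hnn : ∀ i j, 0 ≤ G.weight i j * (v i - v j) ^ 2 := fun i j =>
    mul_nonneg (G.weight_nonneg i j) (sq_nonneg _)
  have h0 : ∑ i, ∑ j, G.weight i j * (v i - v j) ^ 2 = 0 := by linarith
  have h1 : ∀ i j, G.weight i j * (v i - v j) ^ 2 = 0 := fun i j =>
    (Finset.sum_eq_zero_iff_of_nonneg fun j _ => hnn i j).1
      ((Finset.sum_eq_zero_iff_of_nonneg fun i _ => Finset.sum_nonneg fun j _ => hnn i j).1 h0 i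
        (Finset.mem_univ i)) j (Finset.mem_univ j)
  induction hconn i j with
  | refl => rfl
  | tail _ hbc ih =>
    rw [ih]
    have := (mul_eq_zero.1 (h1 _ _)).resolve_left (ne_of_gt hbc)
    exact sub_eq_zero.1 (pow_eq_zero_iff two_ne_zero |>.1 this)

/-- The second smallest eigenvalue of the symmetrized Laplacian of a strongly connected
weight-balanced digraph is positive, and bounds its quadratic form below off consensus. -/
theorem secondSmallestEigenvalue_gap (hn : 2 ≤ n) (hconn : G.StronglyConnected)
    (hbal : G.WeightBalanced) :
    0 < secondSmallestEigenvalue hn G.symLaplacian_isHermitian ∧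
      ∀ v : Fin n → ℝ, ∑ i, v i = 0 →
        secondSmallestEigenvalue hn G.symLaplacian_isHermitian * ∑ i, v i ^ 2
          ≤ ∑ i, v i * ∑ j, G.laplacian i j * v j := by
  set T := Matrix.toEuclideanLin G.symLaplacian with hTdef
  have hT : T.IsSymmetric := Matrix.isSymmetric_toEuclideanLin_iff.mpr G.symLaplacian_isHermitian
  have hTq : ∀ v : EuclideanSpace ℝ (Fin n), ⟪v, T v⟫ = ∑ i, v i * ∑ j, G.laplacian i j * v j := by
    intro v
    rw [← quadraticForm_symLaplacian, PiLp.inner_apply]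
    refine Finset.sum_congr rfl fun i _ => ?_
    simp [T, Matrix.mulVec, dotProduct, mul_comm]
  set o : EuclideanSpace ℝ (Fin n) := WithLp.toLp 2 fun _ => 1 with hodef
  have ho : T o = 0 := by
    ext i
    have h1 := G.sum_laplacian_row i
    have h2 := hbal.sum_laplacian_col i
    simp [T, o, Matrix.mulVec, dotProduct, symLaplacian, h1, h2]
  have ho0 : o ≠ 0 := by
    intro h
    have := congrArg (fun v : EuclideanSpace ℝ (Fin n) => v ⟨0, by omega⟩) h
    simp [o] at this
  obtain ⟨h1, h2⟩ := hT.eigenvalue_gap (n := Fintype.card (Fin n)) finrank_euclideanSpace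
    (by simpa using hn) (fun v => by rw [hTq]; exact quadraticForm_nonneg hbal _) ho ho0 (by
      intro v hv
      have hq : ∑ i, v i * ∑ j, G.laplacian i j * v j = 0 := by rw [← hTq, hv, inner_zero_right]
      refine ⟨v ⟨0, by omega⟩, ?_⟩
      ext i
      simpa [o] using hconn.eq_of_quadraticForm_eq_zero hbal hq i _)
  have hidx : secondSmallestEigenvalue hn G.symLaplacian_isHermitian
      = hT.eigenvalues finrank_euclideanSpace ⟨Fintype.card (Fin n) - 2, by simp; omega⟩ := by
    rw [secondSmallestEigenvalue, Matrix.IsHermitian.eigenvalues₀]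
    congr 1
    simp
  rw [hidx]
  refine ⟨h1, fun v hv => ?_⟩
  have h3 := h2 (WithLp.toLp 2 v) (by simpa [o, PiLp.inner_apply] using hv)
  rw [hTq, EuclideanSpace.real_norm_sq_eq] at h3
  exact h3

end WeightedDigraph

/-! ### Strong convexity and KKT points -/

/-- The first-order lower bound for a differentiable strongly convex function. -/
theorem StrongConvexOn.gradient_lower_bound {E : Type*} [NormedAddCommGroup E]
    [InnerProductSpace ℝ E] [CompleteSpace E] {f : E → ℝ} {m : ℝ}
    (hf : StrongConvexOn Set.univ m f) {x : E} (hd : DifferentiableAt ℝ f x) (y : E) :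
    f x + ⟪∇ f x, y - x⟫ + m / 2 * ‖y - x‖ ^ 2 ≤ f y := by
  have hline : HasDerivAt (fun t : ℝ => x + t • (y - x)) (y - x) 0 := by
    simpa using ((hasDerivAt_id (0 : ℝ)).smul_const (y - x)).const_add x
  have hder : HasDerivAt (fun t : ℝ => f (x + t • (y - x))) ⟪∇ f x, y - x⟫ 0 := by
    have h1 : HasFDerivAt f (InnerProductSpace.toDual ℝ E (∇ f x)) (x + (0 : ℝ) • (y - x)) := by
      rw [zero_smul, add_zero]
      exact hd.hasGradientAt.hasFDerivAt
    have h2 := h1.comp_hasDerivAt (0 : ℝ) hline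
    rwa [InnerProductSpace.toDual_apply_apply] at h2
  -- For `0 < t < 1` strong convexity bounds the slope along the segment by the function in `hlim2`;
  -- let `t` decrease to zero.
  have hlim := hder.tendsto_slope_zero_right
  have hlim2 : Tendsto (fun t : ℝ => f y - f x - (1 - t) * (m / 2 * ‖y - x‖ ^ 2)) (𝓝[>] 0)
      (𝓝 (f y - f x - (1 - 0) * (m / 2 * ‖y - x‖ ^ 2))) := by
    refine Tendsto.mono_left ?_ nhdsWithin_le_nhds
    exact Continuous.tendsto (by fun_prop) 0
  have hle := le_of_tendsto_of_tendsto hlim hlim2 (by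
    filter_upwards [self_mem_nhdsWithin,
      mem_nhdsWithin_of_mem_nhds (Iio_mem_nhds (zero_lt_one (α := ℝ)))] with t h0 h1
    have h0' : 0 < t := h0
    have h1' : t < 1 := h1
    have hc := hf.2 (Set.mem_univ x) (Set.mem_univ y) (sub_nonneg.2 h1'.le) h0'.le (by ring)
    have e : (1 - t) • x + t • y = x + t • (y - x) := by
      rw [sub_smul, one_smul, smul_sub]; abel
    rw [e, norm_sub_rev] at hc
    simp only [smul_eq_mul, zero_add, zero_smul, add_zero] at hc ⊢
    rw [inv_mul_le_iff₀ h0']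
    linarith)
  linarith

/-- Strong monotonicity of a field that satisfies the first-order lower bound. -/
theorem inner_sub_ge_of_lower_bound {X : Type*} [NormedAddCommGroup X] [InnerProductSpace ℝ X]
    {f : X → ℝ} {F : X → X} {μ : ℝ}
    (hf : ∀ x y, f x + ⟪F x, y - x⟫ + μ / 2 * ‖y - x‖ ^ 2 ≤ f y) (x y : X) :
    μ * ‖x - y‖ ^ 2 ≤ ⟪x - y, F x - F y⟫ := by
  have h1 := hf x y
  have h2 := hf y x
  rw [norm_sub_rev, ← neg_sub x y, inner_neg_right] at h1
  rw [inner_sub_right, real_inner_comm, real_inner_comm (F y)]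
  linarith

/-- A linearly constrained strongly convex problem has a point satisfying the KKT conditions. -/
theorem exists_kkt {X V : Type*} [NormedAddCommGroup X] [InnerProductSpace ℝ X]
    [FiniteDimensional ℝ X] [NormedAddCommGroup V] [InnerProductSpace ℝ V] [FiniteDimensional ℝ V]
    {f : X → ℝ} {F : X → X} {μ : ℝ} (hμ : 0 < μ) (hfc : Continuous f) (hFc : Continuous F)
    (hf : ∀ x y, f x + ⟪F x, y - x⟫ + μ / 2 * ‖y - x‖ ^ 2 ≤ f y)
    (C : X →ₗ[ℝ] V) (b : V) (hfeas : ∃ x, C x = b) :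
    ∃ x l, C x = b ∧ F x + LinearMap.adjoint C l = 0 := by
  obtain ⟨x₀, hx₀⟩ := hfeas
  have hclosed : IsClosed {x | C x = b} :=
    isClosed_eq C.continuous_of_finiteDimensional continuous_const
  -- Beyond distance `2 * ‖F x₀‖ / μ` from `x₀`, the quadratic term outweighs the linear one, so a
  -- minimizer exists.
  have hev : ∀ᶠ y in cocompact X ⊓ 𝓟 {x | C x = b}, f x₀ ≤ f y := by
    refine Filter.Eventually.filter_mono inf_le_left ?_
    have := (tendsto_norm_cocompact_atTop (E := X)).eventually_ge_atTop
      (‖x₀‖ + 2 * ‖F x₀‖ / μ)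
    filter_upwards [this] with y hy
    have h1 := hf x₀ y
    have h2 := (abs_le.1 (abs_real_inner_le_norm (F x₀) (y - x₀))).1
    have h3 : 2 * ‖F x₀‖ / μ ≤ ‖y - x₀‖ := by
      have := norm_sub_norm_le y x₀
      linarith
    rw [div_le_iff₀ hμ] at h3
    have h4 : ‖F x₀‖ * ‖y - x₀‖ ≤ μ / 2 * ‖y - x₀‖ ^ 2 := by
      have : ‖F x₀‖ ≤ μ / 2 * ‖y - x₀‖ := by linarith
      calc _ ≤ (μ / 2 * ‖y - x₀‖) * ‖y - x₀‖ := by gcongr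
        _ = _ := by ring
    linarith
  obtain ⟨x, hx, hmin⟩ := hfc.continuousOn.exists_isMinOn' hclosed hx₀ hev
  have hx : C x = b := hx
  -- `F` is tied to `f` only by the lower bound, so that bound is applied based at `x + t • v` and
  -- continuity of `F` lets `t` tend to zero.
  have horth : ∀ v ∈ LinearMap.ker C, 0 ≤ ⟪F x, v⟫ := by
    intro v hv
    have hlim : Tendsto (fun t : ℝ => ⟪F (x + t • v), v⟫) (𝓝[>] 0) (𝓝 ⟪F x, v⟫) := by
      refine Tendsto.mono_left ?_ nhdsWithin_le_nhds
      have hc : Continuous fun t : ℝ => ⟪F (x + t • v), v⟫ := by fun_prop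
      simpa using hc.tendsto 0
    refine ge_of_tendsto hlim ?_
    filter_upwards [self_mem_nhdsWithin] with t ht
    have ht : 0 < t := ht
    have h1 : f x ≤ f (x + t • v) := hmin (by
      simp [hx, LinearMap.mem_ker.1 hv])
    have h2 := hf (x + t • v) x
    rw [sub_add_cancel_left, inner_neg_right, inner_smul_right] at h2
    have h3 : 0 ≤ μ / 2 * ‖-(t • v)‖ ^ 2 := by positivity
    exact nonneg_of_mul_nonneg_right (by linarith) ht
  have hmem : -F x ∈ (LinearMap.ker C)ᗮ := by
    rw [Submodule.mem_orthogonal']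
    intro v hv
    have h1 := horth v hv
    have h2 := horth (-v) (neg_mem hv)
    rw [inner_neg_right] at h2
    rw [inner_neg_left]
    linarith
  rw [LinearMap.orthogonal_ker] at hmem
  obtain ⟨l, hl⟩ := hmem
  exact ⟨x, l, hx, by rw [hl, add_neg_cancel]⟩

/-- A KKT point of a linearly constrained strongly convex problem is its strict minimizer. -/
theorem kkt_lower_bound {X V : Type*} [NormedAddCommGroup X] [InnerProductSpace ℝ X]
    [FiniteDimensional ℝ X] [NormedAddCommGroup V] [InnerProductSpace ℝ V] [FiniteDimensional ℝ V]
    {f : X → ℝ} {F : X → X} {μ : ℝ}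
    (hf : ∀ x y, f x + ⟪F x, y - x⟫ + μ / 2 * ‖y - x‖ ^ 2 ≤ f y)
    {C : X →ₗ[ℝ] V} {x y : X} {l : V} (hl : F x + LinearMap.adjoint C l = 0) (hxy : C y = C x) :
    f x + μ / 2 * ‖y - x‖ ^ 2 ≤ f y := by
  have h1 := hf x y
  rw [eq_neg_of_add_eq_zero_left hl, inner_neg_left, LinearMap.adjoint_inner_left, map_sub, hxy,
    sub_self, inner_zero_right] at h1
  linarith

theorem LocallyLipschitz.piMap {ι : Type*} [Fintype ι] {α β : ι → Type*}
    [∀ i, PseudoEMetricSpace (α i)] [∀ i, PseudoEMetricSpace (β i)] {f : ∀ i, α i → β i}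
    (hf : ∀ i, LocallyLipschitz (f i)) : LocallyLipschitz fun (x : ∀ i, α i) i => f i (x i) := by
  intro x
  choose K t ht hK using fun i => hf i (x i)
  refine ⟨∑ i, K i, Set.pi Set.univ t, set_pi_mem_nhds Set.finite_univ fun i _ => ht i, ?_⟩
  intro y hy z hz
  refine edist_pi_le_iff.2 fun i => ?_
  refine (hK i (hy i trivial) (hz i trivial)).trans ?_
  gcongr
  · exact Finset.single_le_sum (f := K) (fun _ _ => bot_le) (Finset.mem_univ i)
  · exact edist_le_pi_edist y z i

/-! ### IDEA as a saddle flow on stacked vectors -/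

namespace CoupledProblem

variable {n p : ℕ} (P : CoupledProblem n p)

/-- The decision variables with their Euclidean norm. -/
abbrev Primal : Type := PiLp 2 fun i => EuclideanSpace ℝ (Fin (P.d i))

/-- One vector of `ℝ^p` for every agent, with the Euclidean norm. -/
abbrev Stacked (n p : ℕ) : Type := PiLp 2 fun _ : Fin n => EuclideanSpace ℝ (Fin p)

/-- The block diagonal constraint map. -/
noncomputable def constraintMap : P.Primal →L[ℝ] Stacked n p where
  toFun x := WithLp.toLp 2 fun i => Matrix.toEuclideanLin (P.A i) (x i)
  map_add' x y := by ext1 i; simp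
  map_smul' c x := by ext1 i; simp
  cont := by
    have := fun i => (Matrix.toEuclideanLin (P.A i)).continuous_of_finiteDimensional
    fun_prop

theorem constraintMap_apply (x : P.Primal) (i : Fin n) :
    P.constraintMap x i = Matrix.toEuclideanLin (P.A i) (x i) := rfl

/-- The action of the Laplacian on stacked vectors. -/
noncomputable def laplacianMap (G : WeightedDigraph n) (p : ℕ) : Stacked n p →L[ℝ] Stacked n p where
  toFun l := WithLp.toLp 2 fun i => ∑ j, G.laplacian i j • l j
  map_add' x y := by ext1 i; simp [Finset.sum_add_distrib]
  map_smul' c x := by ext1 i; simp [Finset.smul_sum, smul_comm c]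
  cont := by fun_prop

theorem laplacianMap_apply (G : WeightedDigraph n) (l : Stacked n p) (i : Fin n) :
    laplacianMap G p l i = ∑ j, G.laplacian i j • l j := rfl

/-- The sum of the blocks. -/
noncomputable def sumMap (n p : ℕ) : Stacked n p →L[ℝ] EuclideanSpace ℝ (Fin p) where
  toFun l := ∑ i, l i
  map_add' x y := by simp [Finset.sum_add_distrib]
  map_smul' c x := by simp [Finset.smul_sum]
  cont := by fun_prop

theorem sumMap_apply (l : Stacked n p) : sumMap n p l = ∑ i, l i := rfl

/-- The stacked vector with all blocks equal. -/
noncomputable def consensus (n : ℕ) {p : ℕ} (v : EuclideanSpace ℝ (Fin p)) : Stacked n p :=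
  WithLp.toLp 2 fun _ => v

theorem inner_consensus (v : EuclideanSpace ℝ (Fin p)) (z : Stacked n p) :
    ⟪consensus n v, z⟫ = ⟪v, sumMap n p z⟫ := by
  rw [PiLp.inner_apply, sumMap_apply, inner_sum]
  rfl

theorem norm_sq_stacked (l : Stacked n p) : ‖l‖ ^ 2 = ∑ k, ∑ i, l i k ^ 2 := by
  rw [PiLp.norm_sq_eq_of_L2, Finset.sum_comm]
  exact Finset.sum_congr rfl fun i _ => EuclideanSpace.real_norm_sq_eq _

section Laplacian

variable {G : WeightedDigraph n}

theorem laplacianMap_consensus (G : WeightedDigraph n) (v : EuclideanSpace ℝ (Fin p)) :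
    laplacianMap G p (consensus n v) = 0 := by
  ext1 i
  rw [laplacianMap_apply]
  simp only [consensus, ← Finset.sum_smul, G.sum_laplacian_row i, zero_smul]
  rfl

theorem sumMap_laplacianMap (hbal : G.WeightBalanced) (l : Stacked n p) :
    sumMap n p (laplacianMap G p l) = 0 := by
  simp only [sumMap_apply, laplacianMap_apply]
  rw [Finset.sum_comm]
  simp [← Finset.sum_smul, hbal.sum_laplacian_col]

/-- `L ⊗ I_p` acts as a copy of `L` on each coordinate `k`; with `k` summed outermost, the scalar
results apply coordinatewise. -/
theorem inner_laplacianMap (G : WeightedDigraph n) (l : Stacked n p) :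
    ⟪l, laplacianMap G p l⟫ = ∑ k, ∑ i, l i k * ∑ j, G.laplacian i j * l j k := by
  rw [PiLp.inner_apply, Finset.sum_comm]
  refine Finset.sum_congr rfl fun i _ => ?_
  rw [PiLp.inner_apply]
  refine Finset.sum_congr rfl fun k _ => ?_
  simp [laplacianMap_apply, mul_comm]

theorem inner_laplacianMap_nonneg (hbal : G.WeightBalanced) (l : Stacked n p) :
    0 ≤ ⟪l, laplacianMap G p l⟫ := by
  rw [inner_laplacianMap]
  exact Finset.sum_nonneg fun k _ => WeightedDigraph.quadraticForm_nonneg hbal fun i => l i k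

/-- Every stacked vector splits into a consensus part and a part controlled by the Laplacian. -/
theorem exists_consensus_decomposition (hn : 2 ≤ n) (hconn : G.StronglyConnected)
    (hbal : G.WeightBalanced) (l : Stacked n p) :
    ∃ v w, l = consensus n v + w ∧
      secondSmallestEigenvalue hn G.symLaplacian_isHermitian * ‖w‖ ^ 2
        ≤ ⟪l, laplacianMap G p l⟫ := by
  have hn0 : (n : ℝ) ≠ 0 := by positivity
  set v := (1 / (n : ℝ)) • sumMap n p l with hv
  have hw : sumMap n p (l - consensus n v) = 0 := by
    rw [map_sub, sumMap_apply (consensus n v)]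
    simp only [consensus, Finset.sum_const, Finset.card_univ, Fintype.card_fin]
    rw [← Nat.cast_smul_eq_nsmul ℝ, hv, smul_smul, mul_one_div_cancel hn0, one_smul, sub_self]
  refine ⟨v, l - consensus n v, by abel, ?_⟩
  -- Zero row sums remove the consensus part from the right argument, zero column sums from the left
  -- one.
  have hq : ⟪l, laplacianMap G p l⟫
      = ⟪l - consensus n v, laplacianMap G p (l - consensus n v)⟫ := by
    rw [map_sub, laplacianMap_consensus, sub_zero, inner_sub_left, inner_consensus,
      sumMap_laplacianMap hbal, inner_zero_right, sub_zero]
  rw [hq, inner_laplacianMap, norm_sq_stacked, Finset.mul_sum]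
  refine Finset.sum_le_sum fun k _ =>
    (G.secondSmallestEigenvalue_gap hn hconn hbal).2 (fun i => (l - consensus n v) i k) ?_
  have := congrArg (fun z : EuclideanSpace ℝ (Fin p) => z k) hw
  simpa [sumMap_apply] using this

/-- A zero-sum `z` is orthogonal to consensus vectors, so only the part of `l` controlled by the
Laplacian meets it; Cauchy–Schwarz does the rest. -/
theorem laplacianMap_gap (hn : 2 ≤ n) (hconn : G.StronglyConnected) (hbal : G.WeightBalanced)
    (l z : Stacked n p) (hz : sumMap n p z = 0) :
    secondSmallestEigenvalue hn G.symLaplacian_isHermitian * ⟪l, z⟫ ^ 2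
      ≤ ⟪l, laplacianMap G p l⟫ * ‖z‖ ^ 2 := by
  have hη := (G.secondSmallestEigenvalue_gap hn hconn hbal).1
  obtain ⟨v, w, hl, hw⟩ := exists_consensus_decomposition hn hconn hbal l
  have h1 : ⟪l, z⟫ = ⟪w, z⟫ := by
    rw [hl, inner_add_left, inner_consensus, hz, inner_zero_right, zero_add]
  have h2 : ⟪w, z⟫ ^ 2 ≤ ‖w‖ ^ 2 * ‖z‖ ^ 2 := by
    rw [← sq_abs, ← mul_pow]
    gcongr
    exact abs_real_inner_le_norm w z
  calc _ ≤ secondSmallestEigenvalue hn G.symLaplacian_isHermitian * (‖w‖ ^ 2 * ‖z‖ ^ 2) := by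
        rw [h1]; gcongr
    _ = secondSmallestEigenvalue hn G.symLaplacian_isHermitian * ‖w‖ ^ 2 * ‖z‖ ^ 2 := by ring
    _ ≤ _ := by gcongr

/-- The Laplacian ignores the consensus part of `l`, and the quadratic form bounds the other part
through the spectral gap. -/
theorem norm_laplacianMap_sq_le (hn : 2 ≤ n) (hconn : G.StronglyConnected)
    (hbal : G.WeightBalanced) (l : Stacked n p) :
    ‖laplacianMap G p l‖ ^ 2
      ≤ ‖laplacianMap G p‖ ^ 2 / secondSmallestEigenvalue hn G.symLaplacian_isHermitian
        * ⟪l, laplacianMap G p l⟫ := by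
  have hη := (G.secondSmallestEigenvalue_gap hn hconn hbal).1
  obtain ⟨v, w, hl, hw⟩ := exists_consensus_decomposition hn hconn hbal l
  have h1 : laplacianMap G p l = laplacianMap G p w := by
    rw [hl, map_add, laplacianMap_consensus, zero_add]
  calc ‖laplacianMap G p l‖ ^ 2 ≤ (‖laplacianMap G p‖ * ‖w‖) ^ 2 := by
        rw [h1]; gcongr; exact ContinuousLinearMap.le_opNorm _ _
    _ = ‖laplacianMap G p‖ ^ 2 / secondSmallestEigenvalue hn G.symLaplacian_isHermitian
        * (secondSmallestEigenvalue hn G.symLaplacian_isHermitian * ‖w‖ ^ 2) := by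
        field_simp
    _ ≤ _ := by gcongr

end Laplacian

/-- Flattening nested blocks to one sigma-indexed vector is an isometry that turns the blockwise map
into the block diagonal matrix. -/
theorem norm_constraintMap_sq_le (x : P.Primal) :
    ‖P.constraintMap x‖ ^ 2 ≤ largestSingularValue P.blockA ^ 2 * ‖x‖ ^ 2 := by
  have h := largestSingularValue_spec P.blockA (WithLp.toLp 2 fun k => x k.1 k.2)
  have h1 : ‖(WithLp.toLp 2 fun k => x k.1 k.2 : EuclideanSpace ℝ ((i : Fin n) × Fin (P.d i)))‖ ^ 2
      = ‖x‖ ^ 2 := by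
    rw [EuclideanSpace.real_norm_sq_eq, PiLp.norm_sq_eq_of_L2, Fintype.sum_sigma]
    exact Finset.sum_congr rfl fun i _ => (EuclideanSpace.real_norm_sq_eq (x i)).symm
  have h2 : ‖Matrix.toEuclideanLin P.blockA (WithLp.toLp 2 fun k => x k.1 k.2)‖ ^ 2
      = ‖P.constraintMap x‖ ^ 2 := by
    rw [EuclideanSpace.real_norm_sq_eq, PiLp.norm_sq_eq_of_L2, Fintype.sum_sigma]
    refine Finset.sum_congr rfl fun i _ => ?_
    rw [EuclideanSpace.real_norm_sq_eq]
    refine Finset.sum_congr rfl fun k _ => ?_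
    congr 1
    simp only [constraintMap_apply, Matrix.toLpLin_apply, Matrix.mulVec, dotProduct, blockA,
      Fintype.sum_sigma, Matrix.blockDiagonal'_apply]
    rw [Finset.sum_eq_single i]
    · simp
    · intro j _ hj
      simp [hj.symm]
    · simp
  rwa [h1, h2] at h

/-- The adjoint of the constraint map acts blockwise by the transposes. -/
theorem inner_constraintMap (x : P.Primal) (y : Stacked n p) :
    ⟪P.constraintMap x, y⟫
      = ⟪x, (WithLp.toLp 2 fun i => Matrix.toEuclideanLin (P.A i).transpose (y i) : P.Primal)⟫ := by
  rw [PiLp.inner_apply, PiLp.inner_apply]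
  refine Finset.sum_congr rfl fun i _ => ?_
  change ⟪Matrix.toEuclideanLin (P.A i) (x i), y i⟫
    = ⟪x i, Matrix.toEuclideanLin (P.A i).transpose (y i)⟫
  rw [← Matrix.conjTranspose_eq_transpose_of_trivial,
    Matrix.toEuclideanLin_conjTranspose_eq_adjoint, LinearMap.adjoint_inner_right]

/-- The stacked gradient. -/
noncomputable def gradientMap (x : P.Primal) : P.Primal :=
  WithLp.toLp 2 fun i => ∇ (P.f i) (x i)

theorem gradientMap_locallyLipschitz (hlip : ∀ i, LocallyLipschitz (∇ (P.f i))) :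
    LocallyLipschitz P.gradientMap := by
  have h := LocallyLipschitz.piMap hlip
  exact ((PiLp.lipschitzWith_toLp 2 _).locallyLipschitz.comp h).comp
    (PiLp.lipschitzWith_ofLp 2 _).locallyLipschitz

theorem cost_lower_bound {μ : Fin n → ℝ}
    (hstrong : ∀ i, StrongConvexOn Set.univ (μ i) (P.f i)) (hdiff : ∀ i, Differentiable ℝ (P.f i))
    (x y : P.Primal) :
    P.cost x + ⟪P.gradientMap x, y - x⟫ + (⨅ i, μ i) / 2 * ‖y - x‖ ^ 2 ≤ P.cost y := by
  rw [PiLp.inner_apply, PiLp.norm_sq_eq_of_L2, Finset.mul_sum, cost, cost,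
    ← Finset.sum_add_distrib, ← Finset.sum_add_distrib]
  refine Finset.sum_le_sum fun i _ => le_trans ?_
    ((hstrong i).gradient_lower_bound ((hdiff i) (x i)) (y i))
  have : (⨅ i, μ i) ≤ μ i := ciInf_le (Set.finite_range μ).bddBelow i
  simp only [PiLp.sub_apply, gradientMap]
  gcongr

/-- The saddle system behind IDEA. -/
noncomputable def saddleSystem (hn : 2 ≤ n) (P : CoupledProblem n p) (G : WeightedDigraph n)
    (hconn : G.StronglyConnected) (hbal : G.WeightBalanced)
    (μ : Fin n → ℝ) (hμ : ∀ i, 0 < μ i)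
    (hstrong : ∀ i, StrongConvexOn Set.univ (μ i) (P.f i))
    (hdiff : ∀ i, Differentiable ℝ (P.f i))
    (hlip : ∀ i, LocallyLipschitz (∇ (P.f i)))
    (bloc : Fin n → EuclideanSpace ℝ (Fin p))
    (φ α β : ℝ) (hφ : 0 < φ) (hα_pos : 0 < α)
    (hα : (φ ^ 2 + 3 * φ + 3) * largestSingularValue P.blockA ^ 2 / ((φ + 1) * ⨅ i, μ i) ≤ α)
    (hβ : (φ + 1) ^ 2 * α / (φ * secondSmallestEigenvalue hn G.symLaplacian_isHermitian) ≤ β) :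
    SaddleSystem P.Primal (Stacked n p) (EuclideanSpace ℝ (Fin p)) :=
  have hμ_pos : 0 < ⨅ i, μ i := by
    have : Nonempty (Fin n) := ⟨⟨0, by omega⟩⟩
    obtain ⟨i, hi⟩ := exists_eq_ciInf_of_finite (f := μ)
    rw [← hi]
    exact hμ i
  have hη := (G.secondSmallestEigenvalue_gap hn hconn hbal).1
  { F := P.gradientMap
    A := P.constraintMap
    L := laplacianMap G p
    S := sumMap n p
    c := WithLp.toLp 2 bloc
    α := α
    β := β
    φ := φ
    μ := ⨅ i, μ i
    σ := largestSingularValue P.blockA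
    η := secondSmallestEigenvalue hn G.symLaplacian_isHermitian
    C := ‖laplacianMap G p‖ ^ 2 / secondSmallestEigenvalue hn G.symLaplacian_isHermitian
    F_lip := P.gradientMap_locallyLipschitz hlip
    F_mono := inner_sub_ge_of_lower_bound (f := fun x : P.Primal => P.cost x)
      (P.cost_lower_bound hstrong hdiff)
    A_le := P.norm_constraintMap_sq_le
    S_L := sumMap_laplacianMap hbal
    L_nonneg := inner_laplacianMap_nonneg hbal
    L_le := norm_laplacianMap_sq_le hn hconn hbal
    L_gap := laplacianMap_gap hn hconn hbal
    μ_pos := hμ_pos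
    η_pos := hη
    α_pos := hα_pos
    φ_pos := hφ
    α_ge := (div_le_iff₀ (by positivity)).1 hα
    β_ge := (div_le_iff₀ (by positivity)).1 hβ }

/-- States with their Euclidean structure. -/
noncomputable def stateEquiv : P.State ≃L[ℝ] P.Primal × Stacked n p × Stacked n p :=
  (PiLp.continuousLinearEquiv 2 ℝ fun i => EuclideanSpace ℝ (Fin (P.d i))).symm.prodCongr
    ((PiLp.continuousLinearEquiv 2 ℝ fun _ : Fin n => EuclideanSpace ℝ (Fin p)).symm.prodCongr
      (PiLp.continuousLinearEquiv 2 ℝ fun _ : Fin n => EuclideanSpace ℝ (Fin p)).symm)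

end CoupledProblem

/-! ### Convergence of IDEA -/

open CoupledProblem in
theorem theorem3 {n p : ℕ} (hn : 2 ≤ n) (P : CoupledProblem n p) (G : WeightedDigraph n)
    (hconn : G.StronglyConnected) (hbal : G.WeightBalanced)
    (μ : Fin n → ℝ) (hμ : ∀ i, 0 < μ i)
    (hstrong : ∀ i, StrongConvexOn Set.univ (μ i) (P.f i))
    (hdiff : ∀ i, Differentiable ℝ (P.f i))
    (hlip : ∀ i, LocallyLipschitz (∇ (P.f i)))
    (hfeas : ∃ x, P.Feasible x)
    (bloc : Fin n → EuclideanSpace ℝ (Fin p)) (hbloc : ∑ i, bloc i = P.b)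
    (φ α β : ℝ) (hφ : 0 < φ) (hα_pos : 0 < α)
    (hα : (φ ^ 2 + 3 * φ + 3) * largestSingularValue P.blockA ^ 2 / ((φ + 1) * ⨅ i, μ i) ≤ α)
    (hβ : (φ + 1) ^ 2 * α / (φ * secondSmallestEigenvalue hn G.symLaplacian_isHermitian) ≤ β)
    (s₀ : P.State) (hz₀ : ∑ i, s₀.2.2 i = 0) :
    (∃ u : ℝ → P.State, u 0 = s₀ ∧ P.IsIdeaTrajectory G bloc α β u) ∧
    ∀ u : ℝ → P.State, u 0 = s₀ → P.IsIdeaTrajectory G bloc α β u →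
      ∃ s : P.State, P.IsIdeaEquilibrium G bloc α β s ∧
        (P.IsOptimal s.1 ∧ ∀ y, P.IsOptimal y → y = s.1) ∧
        Tendsto u atTop (𝓝 s) := by
  set D := saddleSystem hn P G hconn hbal μ hμ hstrong hdiff hlip bloc φ α β hφ hα_pos hα hβ
  have hAt : ∀ y : Stacked n p,
      D.At y = WithLp.toLp 2 fun i => Matrix.toEuclideanLin (P.A i).transpose (y i) := by
    intro y
    refine ext_inner_left ℝ fun x => ?_
    rw [D.inner_At]
    exact P.inner_constraintMap x y
  have hfield : ∀ s, P.stateEquiv (P.ideaField G bloc α β s) = D.field (P.stateEquiv s) := by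
    intro s
    simp only [SaddleSystem.field, hAt]
    rfl
  have hlow := P.cost_lower_bound hstrong hdiff
  have hcostc : Continuous fun x : P.Primal => P.cost x := by
    have := fun i => (hdiff i).continuous
    unfold cost
    fun_prop
  set C : P.Primal →ₗ[ℝ] EuclideanSpace ℝ (Fin p) :=
    ((sumMap n p).comp P.constraintMap).toLinearMap with hC
  have hCf : ∀ x : P.Primal, C x = P.b ↔ P.Feasible x := fun x => Iff.rfl
  obtain ⟨x, l, hx, hl⟩ := exists_kkt D.μ_pos hcostc D.F_lip.continuous hlow C P.b
    (hfeas.imp' (fun x => WithLp.toLp 2 x) fun x hx => hx)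
  have hopt : P.IsOptimal x ∧ ∀ y, P.IsOptimal y → y = x.ofLp := by
    have hμ0 : 0 < ⨅ i, μ i := D.μ_pos
    have hmin : ∀ y : P.Primal, P.Feasible y →
        P.cost x + (⨅ i, μ i) / 2 * ‖y - x‖ ^ 2 ≤ P.cost y := fun y hy =>
      kkt_lower_bound (f := fun x : P.Primal => P.cost x) hlow hl (((hCf y).2 hy).trans hx.symm)
    refine ⟨⟨(hCf x).1 hx, fun y hy => ?_⟩, fun y hy => ?_⟩
    · have h1 := hmin (WithLp.toLp 2 y) hy
      have h2 : 0 ≤ (⨅ i, μ i) / 2 * ‖WithLp.toLp 2 y - x‖ ^ 2 := by positivity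
      exact (le_add_of_nonneg_right h2).trans h1
    · have h1 := (hmin (WithLp.toLp 2 y) hy.1).trans (hy.2 x ((hCf x).1 hx))
      have h2 : (⨅ i, μ i) / 2 * ‖WithLp.toLp 2 y - x‖ ^ 2 ≤ 0 := by linarith
      have h3 : ‖WithLp.toLp 2 y - x‖ ^ 2 ≤ 0 := nonpos_of_mul_nonpos_right h2 (by positivity)
      have h4 : WithLp.toLp 2 y - x = 0 := by simpa using h3.antisymm (sq_nonneg _)
      rw [← sub_eq_zero.1 h4]
  -- The common multiplier is copied to every agent, which annihilates the Laplacian term, and `z`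
  -- is chosen to make the residual vanish.
  set e : P.Primal × Stacked n p × Stacked n p :=
    (x, consensus n l, P.constraintMap x - WithLp.toLp 2 bloc) with he_def
  have he : D.IsEquilibrium e := by
    refine ⟨?_, sub_self _, laplacianMap_consensus G l⟩
    -- `C` is the block sum after the constraint map, and the adjoint of the block sum is the
    -- consensus embedding.
    have : D.At (consensus n l) = LinearMap.adjoint C l := by
      refine ext_inner_left ℝ fun y => ?_
      rw [D.inner_At, LinearMap.adjoint_inner_right, real_inner_comm, inner_consensus,
        real_inner_comm]
      rfl
    simp only [he_def, this]
    exact hl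
  have hSe : D.S e.2.2 = 0 := by
    have h1 : sumMap n p (P.constraintMap x) = P.b := hx
    have h2 : sumMap n p (WithLp.toLp 2 bloc) = P.b := hbloc
    change sumMap n p (P.constraintMap x - WithLp.toLp 2 bloc) = 0
    rw [map_sub, h1, h2, sub_self]
  have hS0 : D.S (P.stateEquiv s₀).2.2 = D.S e.2.2 := by
    rw [hSe]; exact hz₀
  obtain ⟨hex, hconv⟩ := D.exists_and_tendsto_of_conj P.stateEquiv hfield he s₀ hS0
  refine ⟨hex, fun u hu0 hu => ?_⟩
  obtain ⟨s, hs, hsx, hlim⟩ := hconv u hu0 hu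
  refine ⟨s, hs, ?_, hlim⟩
  have : s.1 = x.ofLp := by rw [← show WithLp.toLp 2 s.1 = x from hsx]
  rwa [this]
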